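/- Let $\ell,T,h,\theta>0$ and let $\rho_A,\mu,r,\kappa\in L^\infty(0,\ell)$ satisfy, for almost every $x\in(0,\ell)$, $$0<\rho_0\le\rho_A(x)\le\rho_1,\quad 0\le\mu_0\le\mu(x)\le\mu_1,\quad 0<r_0\le r(x)\le r_1,\quad 0<\kappa_0\le\kappa(x)\le\kappa_1 .$$ For $C_g>0$ let $\mathcal G=\{g\in H^1(0,T): g(0)=0,\ \|g\|_{H^1(0,T)}\le C_g\}$, and let $V=\{w\in H^2(0,\ell): w(0)=w'(0)=0\}$. For $g\in\mathcal G$ consider the problem $$\rho_A u_{tt}+\mu u_t+(r u_{xx}+\kappa u_{xxt})_{xx}=0\ \text{ in }(0,\ell)\times(0,T),\qquad u(x,0)=u_t(x,0)=0,$$ $$u(0,t)=u_x(0,t)=0,\quad (r u_{xx}+\kappa u_{xxt})|_{x=\ell}=M(t),\quad -(r u_{xx}+\kappa u_{xxt})_x|_{x=\ell}=g(t),\quad M(t)=\tfrac{2h\cos\theta}{\pi}\,g(t).$$ A weak solution is a function $u\in L^2(0,T;V)$ with $u_t\in L^2(0,T;V)$ and $u(\cdot,0)=0$ such that for all $w\in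 V$ and all $\varphi\in C^\infty(\mathbb R)$ with $\varphi(T)=0$ $$\int_0^T\!\!\int_0^\ell\bigl[-\rho_A u_t w\varphi'+\mu u_t w\varphi+(r u_{xx}+\kappa u_{xxt})w''\varphi\bigr]dx\,dt=\int_0^T\bigl[g(t)w(\ell)+M(t)w'(\ell)\bigr]\varphi(t)\,dt .$$ Then for every $g\in\mathcal G$ there is exactly one weak solution $u(x,t;g)$ on $[0,\ell]\times[0,T]$, so that the input-output (Neumann-to-Dirichlet) operator $\Phi:\mathcal G\to L^2(0,T)$, $(\Phi g)(t):=u(\ell,t;g)$, is well defined, and it is Lipschitz continuous in the sense that $$\|\Phi g_1-\Phi g_2\|_{L^2(0,T)}\le L_0\,\|g_1'-g_2'\|_{L^2(0,T)}\qquad\text{for all } g_1,g_2\in\mathcal G,$$ with the constant $$L_0=\sqrt{\ell^3/3}\;C_1>0,\quad C_1^2=C_0^2(1+C_\theta^2)e^{T},\quad C_0^2=\frac{4(\ell+\ell^3/3)(1+T)}{r_0^2},\quad C_\theta^2=\Bigl(\frac{2h\cos\theta}{\pi}\Bigr)^2 .$$ -/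

import Mathlib

open MeasureTheory Set
open scoped ENNReal ContDiff

noncomputable section

/-- Lebesgue measure on the open interval `(0, L)`. -/
def leb (L : ℝ) : Measure ℝ := volume.restrict (Ioo 0 L)

/-- The derivative of `f` on `[0, L]`, one-sided at the two end points. -/
def dOn (L : ℝ) (f : ℝ → ℝ) : ℝ → ℝ := derivWithin f (Icc 0 L)

/-- `f`, restricted to `[0, L]`, is the continuous representative of an element of the Sobolev
space `H¹(0, L)`: it is absolutely continuous with square integrable derivative. Its weak
derivative is `dOn L f`. -/
def MemH1 (L : ℝ) (f : ℝ → ℝ) : Prop :=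
  AbsolutelyContinuousOnInterval f 0 L ∧ MemLp (dOn L f) 2 (leb L)

/-- The norm of `H¹(0, L)`. -/
def h1Norm (L : ℝ) (f : ℝ → ℝ) : ℝ :=
  Real.sqrt ((∫ t, f t ^ 2 ∂(leb L)) + ∫ t, dOn L f t ^ 2 ∂(leb L))

/-- `f`, restricted to `[0, L]`, is the continuously differentiable representative of an element
of the Sobolev space `H²(0, L)`. -/
def MemH2 (L : ℝ) (f : ℝ → ℝ) : Prop :=
  DifferentiableOn ℝ f (Icc 0 L) ∧ MemH1 L (dOn L f)

/-- The energy space `V` of the beam clamped at the left end: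
`v ∈ H²(0, L)` with `v(0) = v'(0) = 0`. -/
def MemV (L : ℝ) (v : ℝ → ℝ) : Prop :=
  MemH2 L v ∧ v 0 = 0 ∧ dOn L v 0 = 0

/-- The data of the vibrating cantilever with damping. -/
structure Beam where
  /-- length of the beam -/
  len : ℝ
  /-- final time -/
  T : ℝ
  /-- tip length -/
  h : ℝ
  /-- half-conic angle -/
  θ : ℝ
  /-- mass per unit length `ρ_A(x)` -/
  ρ : ℝ → ℝ
  /-- viscous damping coefficient `μ(x)` -/
  μ : ℝ → ℝ
  /-- flexural rigidity `r(x)` -/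
  r : ℝ → ℝ
  /-- Kelvin-Voigt damping coefficient `κ(x)` -/
  κ : ℝ → ℝ
  /-- bounds of the coefficients -/
  (ρ₀ ρ₁ μ₀ μ₁ r₀ r₁ κ₀ κ₁ : ℝ)

namespace Beam

/-- The basic conditions on the beam: positive geometric constants, and coefficients in
`L^∞(0, ℓ)` with the usual two-sided bounds (almost everywhere). -/
structure BasicConditions (B : Beam) : Prop where
  len_pos : 0 < B.len
  T_pos : 0 < B.T
  h_pos : 0 < B.h
  θ_pos : 0 < B.θ
  ρ_mem : MemLp B.ρ ∞ (leb B.len)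
  μ_mem : MemLp B.μ ∞ (leb B.len)
  r_mem : MemLp B.r ∞ (leb B.len)
  κ_mem : MemLp B.κ ∞ (leb B.len)
  ρ₀_pos : 0 < B.ρ₀
  μ₀_nonneg : 0 ≤ B.μ₀
  r₀_pos : 0 < B.r₀
  κ₀_pos : 0 < B.κ₀
  ρ_bounds : ∀ᵐ x ∂(leb B.len), B.ρ₀ ≤ B.ρ x ∧ B.ρ x ≤ B.ρ₁
  μ_bounds : ∀ᵐ x ∂(leb B.len), B.μ₀ ≤ B.μ x ∧ B.μ x ≤ B.μ₁
  r_bounds : ∀ᵐ x ∂(leb B.len), B.r₀ ≤ B.r x ∧ B.r x ≤ B.r₁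
  κ_bounds : ∀ᵐ x ∂(leb B.len), B.κ₀ ≤ B.κ x ∧ B.κ x ≤ B.κ₁

/-- The set of admissible shear forces:
`g ∈ H¹(0, T)` with `g(0) = 0` and `‖g‖_{H¹(0, T)} ≤ Cg`. -/
def admissible (B : Beam) (Cg : ℝ) : Set (ℝ → ℝ) :=
  {g | MemH1 B.T g ∧ g 0 = 0 ∧ h1Norm B.T g ≤ Cg}

/-- The factor in the relation `M(t) = (2 h cos θ / π) g(t)` between the bending moment and the
shear force at the tip. -/
def momentFactor (B : Beam) : ℝ := 2 * B.h * Real.cos B.θ / Real.pi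

/-- Lebesgue measure on the space-time rectangle `(0, ℓ) × (0, T)`. -/
def lebΩ (B : Beam) : Measure (ℝ × ℝ) := volume.restrict (Ioo 0 B.len ×ˢ Ioo 0 B.T)

/-- The spatial derivative `w_x (x, t)`. -/
def dx (B : Beam) (w : ℝ → ℝ → ℝ) (x t : ℝ) : ℝ := dOn B.len (fun y => w y t) x

/-- The second spatial derivative `w_xx (x, t)`. -/
def dxx (B : Beam) (w : ℝ → ℝ → ℝ) (x t : ℝ) : ℝ := dOn B.len (dOn B.len (fun y => w y t)) x

/-- `w ∈ L²(0, T; V)`: `w(·, t) ∈ V` for almost every `t`, and `w`, `w_x`, `w_xx` are square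
integrable on `(0, ℓ) × (0, T)`. -/
structure MemL2V (B : Beam) (w : ℝ → ℝ → ℝ) : Prop where
  mem_V : ∀ᵐ t ∂(leb B.T), MemV B.len (fun x => w x t)
  memLp : MemLp (fun p : ℝ × ℝ => w p.1 p.2) 2 B.lebΩ
  memLp_dx : MemLp (fun p : ℝ × ℝ => B.dx w p.1 p.2) 2 B.lebΩ
  memLp_dxx : MemLp (fun p : ℝ × ℝ => B.dxx w p.1 p.2) 2 B.lebΩ

/-- `u` has the time derivative `u_t = v` (in the sense of Sobolev spaces in time): for every
`x ∈ [0, ℓ]` the function `u(x, ·)` is a primitive of the integrable function `v(x, ·)`. -/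
def HasTimeDeriv (B : Beam) (u v : ℝ → ℝ → ℝ) : Prop :=
  ∀ x ∈ Icc 0 B.len, IntervalIntegrable (v x) volume 0 B.T ∧
    ∀ t ∈ Icc 0 B.T, u x t = u x 0 + ∫ s in (0 : ℝ)..t, v x s

/-- `u = u(x, t)` is a weak solution of
`ρ u_tt + μ u_t + (r u_xx + κ u_xxt)_xx = 0` in `(0, ℓ) × (0, T)`,
`u(x, 0) = u_t(x, 0) = 0`, `u(0, t) = u_x(0, t) = 0`,
`(r u_xx + κ u_xxt)(ℓ, t) = M(t)`, `-(r u_xx + κ u_xxt)_x (ℓ, t) = g(t)`,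
where `M = (2 h cos θ / π) g`: `u` and `u_t = v` belong to `L²(0, T; V)`, `u(x, 0) = 0`, and the
equation holds when it is multiplied by `w(x) φ(t)` and integrated by parts, for all `w ∈ V` and
all smooth `φ` with `φ(T) = 0`. Since `φ(0)` is free, the last condition contains
`u_t(x, 0) = 0`; it also says that `(ρ u_t)_t` belongs to `L²(0, T; V')` and is given by the
equation. -/
def IsWeakSolution (B : Beam) (g : ℝ → ℝ) (u : ℝ → ℝ → ℝ) : Prop :=
  B.MemL2V u ∧ (∀ x ∈ Icc 0 B.len, u x 0 = 0) ∧
  ∃ v : ℝ → ℝ → ℝ, B.MemL2V v ∧ B.HasTimeDeriv u v ∧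
    ∀ w : ℝ → ℝ, MemV B.len w → ∀ φ : ℝ → ℝ, ContDiff ℝ ∞ φ → φ B.T = 0 →
      ∫ p : ℝ × ℝ,
          (-(B.ρ p.1 * v p.1 p.2 * w p.1 * deriv φ p.2)
            + B.μ p.1 * v p.1 p.2 * w p.1 * φ p.2
            + (B.r p.1 * B.dxx u p.1 p.2 + B.κ p.1 * B.dxx v p.1 p.2)
                * dOn B.len (dOn B.len w) p.1 * φ p.2) ∂B.lebΩ
        = ∫ t, (g t * w B.len + B.momentFactor * g t * dOn B.len w B.len) * φ t ∂(leb B.T)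

open Classical in
/-- The Neumann-to-Dirichlet (input-output) operator `Φ`: `(Φ g)(t) = u(ℓ, t; g)`, where
`u(·, ·; g)` is the weak solution for the shear force `g` (and `0` if there is none). -/
def neumannToDirichlet (B : Beam) (g : ℝ → ℝ) : ℝ → ℝ :=
  if hg : ∃ u, B.IsWeakSolution g u then fun t => hg.choose B.len t else 0

/-- `C_θ² = (2 h cos θ / π)²`. -/
def CθSq (B : Beam) : ℝ := (2 * B.h * Real.cos B.θ / Real.pi) ^ 2

/-- `C_0² = 4 (ℓ + ℓ³ / 3) (1 + T) / r_0²`. -/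
def C0Sq (B : Beam) : ℝ := 4 * (B.len + B.len ^ 3 / 3) * (1 + B.T) / B.r₀ ^ 2

/-- `C_1 = (C_0² (1 + C_θ²) exp T)^{1/2}`. -/
def C1 (B : Beam) : ℝ := Real.sqrt (B.C0Sq * (1 + B.CθSq) * Real.exp B.T)

/-- The Lipschitz constant `L_0 = (ℓ³ / 3)^{1/2} C_1`. -/
def L0 (B : Beam) : ℝ := Real.sqrt (B.len ^ 3 / 3) * B.C1

end Beam

end

set_option linter.unusedSectionVars false

/-- A bounded operator on `L²` given by an operation on functions. -/
noncomputable def l2Op {Ω : Type*} [MeasurableSpace Ω] (μ : Measure Ω) (S : (Ω → ℝ) → Ω → ℝ) (C : ℝ)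
    (hC : 0 ≤ C)
    (hcongr : ∀ f g, f =ᵐ[μ] g → S f =ᵐ[μ] S g)
    (hmem : ∀ f, MemLp f 2 μ → MemLp (S f) 2 μ)
    (hadd : ∀ f g, MemLp f 2 μ → MemLp g 2 μ → S (f + g) =ᵐ[μ] S f + S g)
    (hsmul : ∀ (c : ℝ) f, S (c • f) =ᵐ[μ] c • S f)
    (hbound : ∀ f, MemLp f 2 μ → eLpNorm (S f) 2 μ ≤ ENNReal.ofReal C * eLpNorm f 2 μ) :
    Lp ℝ 2 μ →L[ℝ] Lp ℝ 2 μ :=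
  LinearMap.mkContinuous
    { toFun := fun f => (hmem f (Lp.memLp f)).toLp _
      map_add' := fun f g => by
        rw [← MemLp.toLp_add]
        refine (MemLp.toLp_eq_toLp_iff _ _).2 ?_
        exact (hcongr _ _ (Lp.coeFn_add f g)).trans (hadd _ _ (Lp.memLp f) (Lp.memLp g))
      map_smul' := fun c f => by
        rw [RingHom.id_apply, ← MemLp.toLp_const_smul]
        refine (MemLp.toLp_eq_toLp_iff _ _).2 ?_
        exact (hcongr _ _ (Lp.coeFn_smul c f)).trans (hsmul c f) }
    C (fun f => by
      change ‖(hmem f (Lp.memLp f)).toLp _‖ ≤ _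
      rw [Lp.norm_toLp, Lp.norm_def, ← ENNReal.toReal_ofReal hC, ← ENNReal.toReal_mul]
      exact ENNReal.toReal_mono (ENNReal.mul_ne_top ENNReal.ofReal_ne_top (Lp.eLpNorm_ne_top f))
        (hbound _ (Lp.memLp f)))

theorem coeFn_l2Op {Ω : Type*} [MeasurableSpace Ω] {μ : Measure Ω} {S : (Ω → ℝ) → Ω → ℝ} {C : ℝ}
    {hC hcongr hmem hadd hsmul hbound} (f : Lp ℝ 2 μ) :
    l2Op μ S C hC hcongr hmem hadd hsmul hbound f =ᵐ[μ] S f :=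
  MemLp.coeFn_toLp (hmem f (Lp.memLp f))

theorem inner_l2 {Ω : Type*} [MeasurableSpace Ω] {μ : Measure Ω} (f g : Lp ℝ 2 μ) :
    inner ℝ f g = ∫ p, f p * g p ∂μ := by
  rw [L2.inner_def]
  refine integral_congr_ae (Filter.Eventually.of_forall fun p => ?_)
  simp [mul_comm]

/-- A measurable kernel on `ℝ × ℝ` that is bounded by `1`. -/
structure UnitKernel where
  /-- the underlying function -/
  toFun : ℝ → ℝ → ℝ
  meas : Measurable (Function.uncurry toFun)
  bound : ∀ t s, ‖toFun t s‖ ≤ 1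

namespace UnitKernel

/-- The transposed kernel. -/
def flip (l : UnitKernel) : UnitKernel where
  toFun t s := l.toFun s t
  meas := l.meas.comp measurable_swap
  bound t s := l.bound s t

/-- The kernel of the integration operator `f ↦ ∫₀ᵗ f`. -/
noncomputable def volterra : UnitKernel where
  toFun t s := if s < t then 1 else 0
  meas := Measurable.ite (measurableSet_lt measurable_snd measurable_fst)
    measurable_const measurable_const
  bound t s := by split_ifs <;> simp

/-- The integral operator with kernel `l`, acting on the second variable. -/
noncomputable def intSnd (l : UnitKernel) (β : Measure ℝ) (f : ℝ × ℝ → ℝ) (p : ℝ × ℝ) : ℝ :=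
  ∫ s, l.toFun p.2 s * f (p.1, s) ∂β

variable (l : UnitKernel) {α β : Measure ℝ} [IsFiniteMeasure α] [IsFiniteMeasure β]

theorem intSnd_congr_ae {f g : ℝ × ℝ → ℝ} (h : f =ᵐ[α.prod β] g) :
    ∀ᵐ x ∂α, ∀ t, l.intSnd β f (x, t) = l.intSnd β g (x, t) := by
  filter_upwards [Measure.ae_ae_of_ae_prod h] with x hx t
  refine integral_congr_ae ?_
  filter_upwards [hx] with s hs
  simp [hs]

theorem intSnd_congr {f g : ℝ × ℝ → ℝ} (h : f =ᵐ[α.prod β] g) :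
    l.intSnd β f =ᵐ[α.prod β] l.intSnd β g :=
  (Measure.quasiMeasurePreserving_fst.ae (l.intSnd_congr_ae h)).mono fun p hp => hp p.2

theorem aestronglyMeasurable_intSnd {f : ℝ × ℝ → ℝ} (hf : AEStronglyMeasurable f (α.prod β)) :
    AEStronglyMeasurable (l.intSnd β f) (α.prod β) := by
  refine AEStronglyMeasurable.congr ?_ (l.intSnd_congr hf.ae_eq_mk).symm
  have : StronglyMeasurable (fun q : (ℝ × ℝ) × ℝ => l.toFun q.1.2 q.2 * hf.mk f (q.1.1, q.2)) := by
    refine StronglyMeasurable.mul ?_ ?_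
    · exact (l.meas.comp (by fun_prop : Measurable fun q : (ℝ × ℝ) × ℝ => (q.1.2, q.2))).stronglyMeasurable
    · exact hf.stronglyMeasurable_mk.comp_measurable (by fun_prop)
  exact this.integral_prod_right'.aestronglyMeasurable

theorem memLp_slice {f : ℝ × ℝ → ℝ} (hf : MemLp f 2 (α.prod β)) :
    ∀ᵐ x ∂α, MemLp (fun t => f (x, t)) 2 β := by
  filter_upwards [hf.integrable_sq.prod_right_ae, hf.1.prodMk_left] with x h1 h2
  exact (memLp_two_iff_integrable_sq h2).2 h1

theorem eLpNorm_intSnd_le {f : ℝ × ℝ → ℝ} (hf : AEStronglyMeasurable f (α.prod β)) :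
    eLpNorm (l.intSnd β f) 2 (α.prod β) ≤ β univ * eLpNorm f 2 (α.prod β) := by
  have key : ∀ᵐ x ∂α, ∀ t, ‖l.intSnd β f (x, t)‖ₑ ^ 2 ≤ β univ * ∫⁻ s, ‖f (x, s)‖ₑ ^ 2 ∂β := by
    filter_upwards [hf.prodMk_left] with x hx t
    have h1 : ‖l.intSnd β f (x, t)‖ₑ ≤ eLpNorm (fun s => f (x, s)) 1 β := by
      rw [eLpNorm_one_eq_lintegral_enorm]
      refine (enorm_integral_le_lintegral_enorm _).trans (lintegral_mono fun s => ?_)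
      rw [enorm_mul]
      refine mul_le_of_le_one_left (zero_le) ?_
      have := l.bound t s
      simpa [enorm_le_iff_norm_le] using (enorm_le_iff_norm_le (y := (1:ℝ))).2 (by simpa using this)
    have h2 := eLpNorm_le_eLpNorm_mul_rpow_measure_univ (p := 1) (q := 2) (by norm_num) hx
    have h3 : (∫⁻ s, ‖f (x, s)‖ₑ ^ 2 ∂β) = eLpNorm (fun s => f (x, s)) 2 β ^ 2 := by
      have := eLpNorm_nnreal_pow_eq_lintegral (p := 2) (μ := β) (f := fun s => f (x, s)) (by norm_num)
      simpa using this.symm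
    rw [h3]
    calc ‖l.intSnd β f (x, t)‖ₑ ^ 2
        ≤ (eLpNorm (fun s => f (x, s)) 2 β * β univ ^ (1 / (1 : ℝ≥0∞).toReal - 1 / (2 : ℝ≥0∞).toReal)) ^ 2 := by
          gcongr; exact h1.trans h2
      _ = β univ * eLpNorm (fun s => f (x, s)) 2 β ^ 2 := by
          rw [mul_pow, mul_comm, ← ENNReal.rpow_natCast, ← ENNReal.rpow_mul]
          norm_num
  have e1 : ∀ g : ℝ × ℝ → ℝ, eLpNorm g 2 (α.prod β) ^ 2 = ∫⁻ p, ‖g p‖ₑ ^ 2 ∂(α.prod β) := fun g => by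
    have := eLpNorm_nnreal_pow_eq_lintegral (p := 2) (μ := α.prod β) (f := g) (by norm_num)
    simpa using this
  rw [← ENNReal.pow_le_pow_left_iff (n := 2) (by norm_num), mul_pow, e1, e1,
    lintegral_prod _ (by exact (l.aestronglyMeasurable_intSnd hf).enorm.pow_const 2),
    lintegral_prod _ (by exact hf.enorm.pow_const 2)]
  calc ∫⁻ x, ∫⁻ t, ‖l.intSnd β f (x, t)‖ₑ ^ 2 ∂β ∂α
      ≤ ∫⁻ x, ∫⁻ _, β univ * ∫⁻ s, ‖f (x, s)‖ₑ ^ 2 ∂β ∂β ∂α :=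
        lintegral_mono_ae (key.mono fun x hx => lintegral_mono fun t => hx t)
    _ = ∫⁻ x, β univ ^ 2 * ∫⁻ s, ‖f (x, s)‖ₑ ^ 2 ∂β ∂α := by
        refine lintegral_congr fun x => ?_
        rw [lintegral_const]; ring
    _ = _ := by
        rw [lintegral_const_mul' _ _ (ENNReal.pow_ne_top (measure_ne_top _ _))]

theorem memLp_intSnd {f : ℝ × ℝ → ℝ} (hf : MemLp f 2 (α.prod β)) :
    MemLp (l.intSnd β f) 2 (α.prod β) :=
  ⟨l.aestronglyMeasurable_intSnd hf.1, (l.eLpNorm_intSnd_le hf.1).trans_lt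
    (ENNReal.mul_lt_top (measure_lt_top _ _) hf.2)⟩

theorem integrable_kernel_mul (t : ℝ) {f : ℝ → ℝ} (hf : Integrable f β) :
    Integrable (fun s => l.toFun t s * f s) β :=
  hf.bdd_mul (c := 1) (l.meas.comp (by fun_prop : Measurable fun s : ℝ => (t, s))).aestronglyMeasurable
    (Filter.Eventually.of_forall fun s => l.bound t s)

variable (α β) in
/-- The bounded operator on `L²` of a product given by a kernel acting on the second variable. -/
noncomputable def opSnd : Lp ℝ 2 (α.prod β) →L[ℝ] Lp ℝ 2 (α.prod β) :=
  l2Op (α.prod β) (l.intSnd β) (β univ).toReal ENNReal.toReal_nonneg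
    (fun _ _ h => l.intSnd_congr h)
    (fun _ h => l.memLp_intSnd h)
    (fun f g hf hg => by
      have : ∀ᵐ x ∂α, ∀ t, l.intSnd β (f + g) (x, t) = l.intSnd β f (x, t) + l.intSnd β g (x, t) := by
        filter_upwards [memLp_slice hf, memLp_slice hg] with x h1 h2 t
        rw [intSnd, intSnd, intSnd, ← integral_add]
        · simp [mul_add]
        · exact l.integrable_kernel_mul t (h1.integrable (by norm_num))
        · exact l.integrable_kernel_mul t (h2.integrable (by norm_num))
      exact (Measure.quasiMeasurePreserving_fst.ae this).mono fun p hp => hp p.2)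
    (fun c f => Filter.Eventually.of_forall fun p => by
      simp only [intSnd, Pi.smul_apply, smul_eq_mul, ← integral_const_mul]
      congr 1; ext s; ring)
    (fun f hf => by
      rw [ENNReal.ofReal_toReal (measure_ne_top _ _)]
      exact l.eLpNorm_intSnd_le hf.1)

theorem coeFn_opSnd (f : Lp ℝ 2 (α.prod β)) : l.opSnd α β f =ᵐ[α.prod β] l.intSnd β f :=
  coeFn_l2Op f

theorem inner_opSnd (f g : Lp ℝ 2 (α.prod β)) :
    inner ℝ (l.opSnd α β f) g = inner ℝ f (l.flip.opSnd α β g) := by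
  have hf := Lp.memLp f
  have hg := Lp.memLp g
  have e1 : inner ℝ (l.opSnd α β f) g = ∫ p, l.intSnd β f p * g p ∂(α.prod β) := by
    rw [inner_l2]
    refine integral_congr_ae ?_
    filter_upwards [l.coeFn_opSnd f] with p hp
    rw [hp]
  have e2 : inner ℝ f (l.flip.opSnd α β g) = ∫ p, f p * l.flip.intSnd β g p ∂(α.prod β) := by
    rw [inner_l2]
    refine integral_congr_ae ?_
    filter_upwards [l.flip.coeFn_opSnd g] with p hp
    rw [hp]
  rw [e1, e2, integral_prod (fun p => l.intSnd β f p * g p) ((l.memLp_intSnd hf).integrable_mul hg),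
    integral_prod (fun p => f p * l.flip.intSnd β g p) (hf.integrable_mul (l.flip.memLp_intSnd hg))]
  refine integral_congr_ae ?_
  filter_upwards [memLp_slice hf, memLp_slice hg] with x h1 h2
  have i1 := h1.integrable (q := 2) (by norm_num)
  have i2 := h2.integrable (q := 2) (by norm_num)
  have hi : Integrable (Function.uncurry fun t s => l.toFun t s * (g (x, t) * f (x, s))) (β.prod β) :=
    (i2.mul_prod i1).bdd_mul (c := 1) (f := fun p : ℝ × ℝ => l.toFun p.1 p.2)
      l.meas.aestronglyMeasurable (Filter.Eventually.of_forall fun s => l.bound _ _)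
  calc ∫ t, l.intSnd β f (x, t) * g (x, t) ∂β
      = ∫ t, ∫ s, l.toFun t s * (g (x, t) * f (x, s)) ∂β ∂β := by
        refine integral_congr_ae (Filter.Eventually.of_forall fun t => ?_)
        simp only [intSnd, ← integral_mul_const]
        congr 1; ext s; ring
    _ = ∫ s, ∫ t, l.toFun t s * (g (x, t) * f (x, s)) ∂β ∂β := integral_integral_swap hi
    _ = _ := by
        refine integral_congr_ae (Filter.Eventually.of_forall fun t => ?_)
        simp only [intSnd, flip, ← integral_const_mul]
        congr 1; ext s; ring

/-- The integral operator with kernel `l`, acting on the first variable. -/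
noncomputable def intFst (l : UnitKernel) (α : Measure ℝ) (f : ℝ × ℝ → ℝ) (p : ℝ × ℝ) : ℝ :=
  ∫ y, l.toFun p.1 y * f (y, p.2) ∂α

variable (α β) in
/-- The exchange of the variables on `L²` of a product. -/
noncomputable def swapL2 : Lp ℝ 2 (α.prod β) →L[ℝ] Lp ℝ 2 (β.prod α) :=
  (Lp.compMeasurePreservingₗᵢ ℝ Prod.swap Measure.measurePreserving_swap).toContinuousLinearMap

theorem coeFn_swapL2 (f : Lp ℝ 2 (α.prod β)) :
    swapL2 α β f =ᵐ[β.prod α] fun p => f p.swap :=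
  Lp.coeFn_compMeasurePreserving f Measure.measurePreserving_swap

theorem inner_swapL2 (f : Lp ℝ 2 (α.prod β)) (g : Lp ℝ 2 (β.prod α)) :
    inner ℝ (swapL2 α β f) g = inner ℝ f (swapL2 β α g) := by
  rw [inner_l2, inner_l2]
  rw [← integral_prod_swap]
  refine integral_congr_ae ?_
  filter_upwards [coeFn_swapL2 g, Measure.measurePreserving_swap.quasiMeasurePreserving.ae (coeFn_swapL2 f)]
    with p h1 h2
  rw [h1, h2, Prod.swap_swap]

variable (α β) in
/-- The bounded operator on `L²` of a product given by a kernel acting on the first variable. -/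
noncomputable def opFst : Lp ℝ 2 (α.prod β) →L[ℝ] Lp ℝ 2 (α.prod β) :=
  (swapL2 β α).comp ((l.opSnd β α).comp (swapL2 α β))

theorem coeFn_opFst (f : Lp ℝ 2 (α.prod β)) : l.opFst α β f =ᵐ[α.prod β] l.intFst α f := by
  have h2 := Measure.measurePreserving_swap.quasiMeasurePreserving.ae
    (l.coeFn_opSnd (swapL2 α β f))
  have h3 := Measure.measurePreserving_swap.quasiMeasurePreserving.ae
    (l.intSnd_congr (coeFn_swapL2 f))
  filter_upwards [coeFn_swapL2 (l.opSnd β α (swapL2 α β f)), h2, h3] with p h1 h2 h3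
  change swapL2 β α (l.opSnd β α (swapL2 α β f)) p = _
  rw [h1, h2, h3]
  rfl

theorem inner_opFst (f g : Lp ℝ 2 (α.prod β)) :
    inner ℝ (l.opFst α β f) g = inner ℝ f (l.flip.opFst α β g) := by
  simp only [opFst, ContinuousLinearMap.comp_apply]
  rw [inner_swapL2, inner_opSnd, inner_swapL2]

theorem intFst_congr {f g : ℝ × ℝ → ℝ} (h : f =ᵐ[α.prod β] g) :
    l.intFst α f =ᵐ[α.prod β] l.intFst α g := by
  have h' : (fun p => f p.swap) =ᵐ[β.prod α] fun p => g p.swap :=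
    Measure.measurePreserving_swap.quasiMeasurePreserving.ae h
  exact Measure.measurePreserving_swap.quasiMeasurePreserving.ae (l.intSnd_congr h')

theorem memLp_intFst {f : ℝ × ℝ → ℝ} (hf : MemLp f 2 (α.prod β)) :
    MemLp (l.intFst α f) 2 (α.prod β) :=
  (l.memLp_intSnd (hf.comp_measurePreserving Measure.measurePreserving_swap)).comp_measurePreserving
    Measure.measurePreserving_swap

theorem opFst_opSnd_comm (k l : UnitKernel) (f : Lp ℝ 2 (α.prod β)) :
    k.opFst α β (l.opSnd α β f) = l.opSnd α β (k.opFst α β f) := by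
  refine Lp.ext ?_
  have h1 := (k.coeFn_opFst (l.opSnd α β f)).trans (k.intFst_congr (l.coeFn_opSnd f))
  have h2 := (l.coeFn_opSnd (k.opFst α β f)).trans (l.intSnd_congr (k.coeFn_opFst f))
  refine h1.trans (Filter.EventuallyEq.trans ?_ h2.symm)
  refine Filter.Eventually.of_forall fun p => ?_
  have hf : Integrable f (α.prod β) := (Lp.memLp f).integrable (by norm_num)
  have hi : Integrable (Function.uncurry fun y s => (k.toFun p.1 y * l.toFun p.2 s) * f (y, s)) (α.prod β) := by
    refine hf.bdd_mul (c := 1) (f := fun q : ℝ × ℝ => k.toFun p.1 q.1 * l.toFun p.2 q.2) ?_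
      (Filter.Eventually.of_forall fun q => ?_)
    · refine (Measurable.mul ?_ ?_).aestronglyMeasurable
      · exact k.meas.comp (by fun_prop : Measurable fun q : ℝ × ℝ => (p.1, q.1))
      · exact l.meas.comp (by fun_prop : Measurable fun q : ℝ × ℝ => (p.2, q.2))
    · rw [norm_mul]
      exact mul_le_one₀ (k.bound _ _) (norm_nonneg _) (l.bound _ _)
  calc k.intFst α (l.intSnd β f) p
      = ∫ y, ∫ s, (k.toFun p.1 y * l.toFun p.2 s) * f (y, s) ∂β ∂α := by
        simp only [intFst, intSnd, ← integral_const_mul, mul_assoc]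
    _ = ∫ s, ∫ y, (k.toFun p.1 y * l.toFun p.2 s) * f (y, s) ∂α ∂β := integral_integral_swap hi
    _ = _ := by
        simp only [intFst, intSnd, ← integral_const_mul]
        congr 1; ext s; congr 1; ext y; ring

end UnitKernel

section Mul

variable {Ω : Type*} [MeasurableSpace Ω] {μ : Measure Ω}

/-- Multiplication by an essentially bounded function, as an operator on `L²`. -/
noncomputable def mulOp (m : Ω → ℝ) (hm : MemLp m ∞ μ) : Lp ℝ 2 μ →L[ℝ] Lp ℝ 2 μ :=
  l2Op μ (fun f p => m p * f p) (eLpNorm m ∞ μ).toReal ENNReal.toReal_nonneg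
    (fun f g h => h.mono fun p hp => by simp only [hp])
    (fun f hf => hf.mul' (p := ∞) hm)
    (fun f g _ _ => Filter.Eventually.of_forall fun p => by simp [mul_add])
    (fun c f => Filter.Eventually.of_forall fun p => by simp [mul_left_comm])
    (fun f hf => by
      rw [ENNReal.ofReal_toReal hm.2.ne]
      exact eLpNorm_smul_le_eLpNorm_top_mul_eLpNorm 2 hf.1 m)

theorem coeFn_mulOp (m : Ω → ℝ) (hm : MemLp m ∞ μ) (f : Lp ℝ 2 μ) :
    mulOp m hm f =ᵐ[μ] fun p => m p * f p :=
  coeFn_l2Op f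

theorem inner_mulOp (m : Ω → ℝ) (hm : MemLp m ∞ μ) (f g : Lp ℝ 2 μ) :
    inner ℝ (mulOp m hm f) g = ∫ p, m p * f p * g p ∂μ := by
  rw [inner_l2]
  refine integral_congr_ae ?_
  filter_upwards [coeFn_mulOp m hm f] with p hp
  rw [hp]

theorem inner_mulOp_comm (m : Ω → ℝ) (hm : MemLp m ∞ μ) (f g : Lp ℝ 2 μ) :
    inner ℝ (mulOp m hm f) g = inner ℝ f (mulOp m hm g) := by
  rw [real_inner_comm (mulOp m hm g), inner_mulOp, inner_mulOp]
  congr 1; ext p; ring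

theorem opSnd_mulOp_comm (l : UnitKernel) {α β : Measure ℝ} [IsFiniteMeasure α] [IsFiniteMeasure β]
    (m : ℝ → ℝ) (hm : MemLp (fun p : ℝ × ℝ => m p.1) ∞ (α.prod β)) (f : Lp ℝ 2 (α.prod β)) :
    l.opSnd α β (mulOp _ hm f) = mulOp _ hm (l.opSnd α β f) := by
  refine Lp.ext ?_
  refine ((l.coeFn_opSnd _).trans (l.intSnd_congr (coeFn_mulOp _ hm f))).trans ?_
  filter_upwards [coeFn_mulOp _ hm (l.opSnd α β f), l.coeFn_opSnd f] with p h1 h2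
  rw [h1, h2]
  simp only [UnitKernel.intSnd, ← integral_const_mul]
  congr 1; ext s; ring

end Mul

/-- The primitive of `f` that vanishes at `0`. -/
noncomputable def prim (f : ℝ → ℝ) (x : ℝ) : ℝ := ∫ y in (0 : ℝ)..x, f y

instance (L : ℝ) : IsFiniteMeasure (leb L) :=
  ⟨by rw [leb, Measure.restrict_apply_univ, Real.volume_Ioo]; exact ENNReal.ofReal_lt_top⟩

theorem ae_leb_iff {L : ℝ} {p : ℝ → Prop} :
    (∀ᵐ x ∂(leb L), p x) ↔ ∀ᵐ x, x ∈ Ioo 0 L → p x :=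
  ae_restrict_iff' measurableSet_Ioo

theorem ae_leb_mem (L : ℝ) : ∀ᵐ x ∂(leb L), x ∈ Ioo 0 L := ae_restrict_mem measurableSet_Ioo

theorem integral_leb {L : ℝ} (hL : 0 ≤ L) (f : ℝ → ℝ) : ∫ x, f x ∂(leb L) = ∫ x in (0 : ℝ)..L, f x := by
  rw [leb, intervalIntegral.integral_of_le hL, integral_Ioc_eq_integral_Ioo]

theorem integrable_leb_iff {L : ℝ} (hL : 0 ≤ L) (f : ℝ → ℝ) :
    Integrable f (leb L) ↔ IntervalIntegrable f volume 0 L := by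
  rw [intervalIntegrable_iff_integrableOn_Ioo_of_le hL]; rfl

theorem intervalIntegrable_of_leb {L s t : ℝ} {f : ℝ → ℝ} (hf : Integrable f (leb L))
    (hs : s ∈ Icc 0 L) (ht : t ∈ Icc 0 L) : IntervalIntegrable f volume s t := by
  refine ((integrable_leb_iff (hs.1.trans hs.2) f).1 hf).mono_set ?_
  rw [uIcc_of_le (hs.1.trans hs.2)]
  exact uIcc_subset_Icc hs ht

theorem prim_congr_ae {L t : ℝ} {f g : ℝ → ℝ} (h : f =ᵐ[leb L] g) (ht : t ∈ Icc 0 L) :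
    prim f t = prim g t := by
  refine intervalIntegral.integral_congr_ae ?_
  have h0 : ∀ᵐ x : ℝ, x ≠ t := by simp [ae_iff, measure_singleton]
  filter_upwards [ae_leb_iff.1 h, h0] with x hx hxt hxm
  rw [uIoc_of_le ht.1] at hxm
  exact hx ⟨hxm.1, (lt_of_le_of_ne hxm.2 hxt).trans_le ht.2⟩

theorem integral_volterra {L t : ℝ} (ht : t ∈ Icc 0 L) (f : ℝ → ℝ) :
    ∫ s, UnitKernel.volterra.toFun t s * f s ∂(leb L) = prim f t := by
  have : (fun s => UnitKernel.volterra.toFun t s * f s) = (Iio t).indicator f := by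
    ext s; by_cases h : s < t <;> simp [UnitKernel.volterra, h]
  rw [this, integral_indicator measurableSet_Iio, leb, Measure.restrict_restrict measurableSet_Iio,
    prim, intervalIntegral.integral_of_le ht.1, integral_Ioc_eq_integral_Ioo]
  congr 2
  ext s
  simp only [mem_inter_iff, mem_Iio, mem_Ioo]
  constructor
  · rintro ⟨h1, h2, -⟩; exact ⟨h2, h1⟩
  · rintro ⟨h1, h2⟩; exact ⟨h2, h1, h2.trans_le ht.2⟩

theorem integral_volterra_flip {L t : ℝ} (ht : t ∈ Icc 0 L) (f : ℝ → ℝ) :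
    ∫ s, UnitKernel.volterra.flip.toFun t s * f s ∂(leb L) = ∫ s in t..L, f s := by
  have : (fun s => UnitKernel.volterra.flip.toFun t s * f s) = (Ioi t).indicator f := by
    ext s; by_cases h : t < s <;> simp [UnitKernel.volterra, UnitKernel.flip, h]
  rw [this, integral_indicator measurableSet_Ioi, leb, Measure.restrict_restrict measurableSet_Ioi,
    intervalIntegral.integral_of_le ht.2, integral_Ioc_eq_integral_Ioo]
  congr 2
  ext s
  simp only [mem_inter_iff, mem_Ioi, mem_Ioo]
  constructor
  · rintro ⟨h1, h2, h3⟩; exact ⟨h1, h3⟩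
  · rintro ⟨h1, h2⟩; exact ⟨h1, ht.1.trans_lt h1, h2⟩

theorem AbsolutelyContinuousOnInterval.congr_of_eqOn {f g : ℝ → ℝ} {a b : ℝ}
    (hf : AbsolutelyContinuousOnInterval f a b) (h : ∀ x ∈ uIcc a b, f x = g x) :
    AbsolutelyContinuousOnInterval g a b := by
  rw [absolutelyContinuousOnInterval_iff] at hf ⊢
  intro ε hε
  obtain ⟨δ, hδ, H⟩ := hf ε hε
  refine ⟨δ, hδ, fun E hE hs => ?_⟩
  refine lt_of_eq_of_lt (Finset.sum_congr rfl fun i hi => ?_) (H E hE hs)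
  rw [h _ (hE.1 i hi).1, h _ (hE.1 i hi).2]

theorem absolutelyContinuous_prim {L : ℝ} (hL : 0 ≤ L) {f : ℝ → ℝ} (hf : Integrable f (leb L)) :
    AbsolutelyContinuousOnInterval (prim f) 0 L :=
  ((integrable_leb_iff hL f).1 hf).absolutelyContinuousOnInterval_intervalIntegral (by simp)

theorem continuousOn_prim {L : ℝ} {f : ℝ → ℝ} (hf : Integrable f (leb L)) :
    ContinuousOn (prim f) (Icc 0 L) := by
  rcases le_or_gt 0 L with hL | hL
  · simpa [uIcc_of_le hL] using (absolutelyContinuous_prim hL hf).continuousOn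
  · simp [Icc_eq_empty_of_lt hL]

theorem ae_hasDerivAt_prim {L : ℝ} (hL : 0 ≤ L) {f : ℝ → ℝ} (hf : Integrable f (leb L)) :
    ∀ᵐ x ∂(leb L), HasDerivAt (prim f) (f x) x := by
  rw [ae_leb_iff]
  filter_upwards [((integrable_leb_iff hL f).1 hf).ae_hasDerivAt_integral] with x hx hxm
  exact hx (by rw [uIcc_of_le hL]; exact Ioo_subset_Icc_self hxm) 0 (by simp)

theorem derivWithin_Icc_eq_deriv {L x : ℝ} (hx : x ∈ Ioo 0 L) (f : ℝ → ℝ) :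
    dOn L f x = deriv f x :=
  derivWithin_of_mem_nhds (Icc_mem_nhds hx.1 hx.2)

theorem dOn_congr {L x : ℝ} {f g : ℝ → ℝ} (h : ∀ y ∈ Icc 0 L, f y = g y) (hx : x ∈ Icc 0 L) :
    dOn L f x = dOn L g x :=
  derivWithin_congr h (h x hx)

theorem MemH1.eq_prim {L : ℝ} {f : ℝ → ℝ} (hf : MemH1 L f) {x : ℝ} (hx : x ∈ Icc 0 L) :
    f x = f 0 + prim (dOn L f) x := by
  have h1 := (hf.1.mono (c := 0) (d := x) (by
    rw [uIcc_of_le (hx.1.trans hx.2), uIcc_of_le hx.1]; exact Icc_subset_Icc_right hx.2)).integral_deriv_eq_sub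
  have h2 : prim (dOn L f) x = prim (deriv f) x :=
    prim_congr_ae ((ae_leb_mem L).mono fun y hy => derivWithin_Icc_eq_deriv hy f) hx
  rw [h2, prim, h1]; ring

theorem MemV.dOn_eq_prim {L : ℝ} {f : ℝ → ℝ} (hf : MemV L f) {x : ℝ} (hx : x ∈ Icc 0 L) :
    dOn L f x = prim (dOn L (dOn L f)) x := by
  rw [hf.1.2.eq_prim hx, hf.2.2, zero_add]

theorem MemV.eq_prim {L : ℝ} {f : ℝ → ℝ} (hf : MemV L f) {x : ℝ} (hx : x ∈ Icc 0 L) :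
    f x = prim (prim (dOn L (dOn L f))) x := by
  have hsub : Icc 0 x ⊆ Icc 0 L := Icc_subset_Icc_right hx.2
  have hc : ContinuousOn (dOn L f) (Icc 0 L) := by
    simpa [uIcc_of_le (hx.1.trans hx.2)] using hf.1.2.1.continuousOn
  have h1 : ∫ y in (0 : ℝ)..x, dOn L f y = f x - f 0 := by
    refine intervalIntegral.integral_eq_sub_of_hasDerivAt_of_le hx.1
      (hf.1.1.continuousOn.mono hsub) (fun y hy => ?_) ?_
    · have hy' : y ∈ Ioo 0 L := ⟨hy.1, hy.2.trans_le hx.2⟩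
      exact (hf.1.1 y (Ioo_subset_Icc_self hy')).hasDerivWithinAt.hasDerivAt
        (Icc_mem_nhds hy'.1 hy'.2)
    · exact (hc.mono (by rw [uIcc_of_le hx.1]; exact hsub)).intervalIntegrable
  rw [hf.2.1, sub_zero] at h1
  rw [← h1]
  refine intervalIntegral.integral_congr fun y hy => hf.dOn_eq_prim ?_
  rw [uIcc_of_le hx.1] at hy
  exact hsub hy

theorem hasDerivWithinAt_prim_of_continuousOn {L x : ℝ} {f : ℝ → ℝ}
    (hf : ContinuousOn f (Icc 0 L)) (hx : x ∈ Icc 0 L) :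
    HasDerivWithinAt (prim f) (f x) (Icc 0 L) x := by
  have : Fact (x ∈ Icc 0 L) := ⟨hx⟩
  refine intervalIntegral.integral_hasDerivWithinAt_right ?_ ?_ (hf x hx)
  · exact (hf.mono (by rw [uIcc_of_le hx.1]; exact Icc_subset_Icc_right hx.2)).intervalIntegrable
  · exact hf.stronglyMeasurableAtFilter_nhdsWithin measurableSet_Icc x

section DoublePrimitive

variable {L : ℝ} {f z : ℝ → ℝ}

theorem dOn_of_eq_prim_prim (hL : 0 < L) (hz : Integrable z (leb L))
    (hf : ∀ x ∈ Icc 0 L, f x = prim (prim z) x) {x : ℝ} (hx : x ∈ Icc 0 L) :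
    HasDerivWithinAt f (prim z x) (Icc 0 L) x ∧ dOn L f x = prim z x := by
  have h1 := (hasDerivWithinAt_prim_of_continuousOn (continuousOn_prim hz) hx).congr
    (fun y hy => hf y hy) (hf x hx)
  exact ⟨h1, h1.derivWithin (uniqueDiffOn_Icc hL x hx)⟩

theorem dOn_dOn_of_eq_prim_prim (hL : 0 < L) (hz : Integrable z (leb L))
    (hf : ∀ x ∈ Icc 0 L, f x = prim (prim z) x) : dOn L (dOn L f) =ᵐ[leb L] z := by
  filter_upwards [ae_hasDerivAt_prim hL.le hz, ae_leb_mem L] with x hx hxm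
  rw [dOn_congr (fun y hy => (dOn_of_eq_prim_prim hL hz hf hy).2) (Ioo_subset_Icc_self hxm),
    derivWithin_Icc_eq_deriv hxm, hx.deriv]

theorem memV_of_eq_prim_prim (hL : 0 < L) (hz : MemLp z 2 (leb L))
    (hf : ∀ x ∈ Icc 0 L, f x = prim (prim z) x) : MemV L f := by
  have hzi := hz.integrable (by norm_num)
  have h0 : (0 : ℝ) ∈ Icc 0 L := ⟨le_rfl, hL.le⟩
  refine ⟨⟨fun x hx => (dOn_of_eq_prim_prim hL hzi hf hx).1.differentiableWithinAt, ?_, ?_⟩, ?_, ?_⟩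
  · refine (absolutelyContinuous_prim hL.le hzi).congr_of_eqOn fun x hx => ?_
    rw [uIcc_of_le hL.le] at hx
    exact (dOn_of_eq_prim_prim hL hzi hf hx).2.symm
  · exact (memLp_congr_ae (dOn_dOn_of_eq_prim_prim hL hzi hf)).2 hz
  · rw [hf 0 h0]; simp [prim]
  · rw [(dOn_of_eq_prim_prim hL hzi hf h0).2]; simp [prim]

end DoublePrimitive

theorem integral_mul_prim {L t : ℝ} {f g : ℝ → ℝ} (hf : Integrable f (leb L))
    (hg : Integrable g (leb L)) (ht : t ∈ Icc 0 L) :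
    ∫ s in (0 : ℝ)..t, (f s * prim g s + prim f s * g s) = prim f t * prim g t := by
  have hL : 0 ≤ L := ht.1.trans ht.2
  have hsub : uIcc 0 t ⊆ uIcc 0 L := by
    rw [uIcc_of_le hL, uIcc_of_le ht.1]; exact Icc_subset_Icc_right ht.2
  have h := ((absolutelyContinuous_prim hL hf).mono hsub).integral_deriv_mul_eq_sub
    ((absolutelyContinuous_prim hL hg).mono hsub)
  have h0 : prim f 0 = 0 := by simp [prim]
  rw [h0, zero_mul, sub_zero] at h
  rw [← h]
  refine prim_congr_ae (L := L) ?_ ht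
  filter_upwards [ae_hasDerivAt_prim hL hf, ae_hasDerivAt_prim hL hg] with s h1 h2
  rw [h1.deriv, h2.deriv]

theorem integrable_mul_prim {L : ℝ} {f g : ℝ → ℝ} (hf : Integrable f (leb L))
    (hg : Integrable g (leb L)) : Integrable (fun s => f s * prim g s) (leb L) := by
  rcases le_or_gt 0 L with hL | hL
  · rw [integrable_leb_iff hL] at hf ⊢
    exact hf.mul_continuousOn (absolutelyContinuous_prim hL hg).continuousOn
  · simp [leb, Ioo_eq_empty_of_le hL.le]

theorem integral_mul_prim_self {L t : ℝ} {f : ℝ → ℝ} (hf : Integrable f (leb L))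
    (ht : t ∈ Icc 0 L) : ∫ s in (0 : ℝ)..t, f s * prim f s = prim f t ^ 2 / 2 := by
  have h := integral_mul_prim hf hf ht
  simp only [mul_comm (prim f _) (f _), ← two_mul, intervalIntegral.integral_const_mul] at h
  linarith

theorem prim_prim {L t : ℝ} {f : ℝ → ℝ} (hf : Integrable f (leb L)) (ht : t ∈ Icc 0 L) :
    prim (prim f) t = ∫ s in (0 : ℝ)..t, (t - s) * f s := by
  have hfi := intervalIntegrable_of_leb hf ⟨le_rfl, ht.1.trans ht.2⟩ ht
  have h := integral_mul_prim hf (integrable_const (1 : ℝ)) ht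
  have hp : ∀ s, prim (fun _ => (1 : ℝ)) s = s := fun s => by simp [prim]
  simp only [hp, mul_one] at h
  have hfs : IntervalIntegrable (fun s => f s * s) volume 0 t := hfi.mul_continuousOn continuousOn_id
  rw [intervalIntegral.integral_add hfs (((continuousOn_prim hf).mono (by
      rw [uIcc_of_le ht.1]; exact Icc_subset_Icc_right ht.2)).intervalIntegrable)] at h
  have h2 : ∫ s in (0 : ℝ)..t, (t - s) * f s = t * prim f t - ∫ s in (0 : ℝ)..t, f s * s := by
    rw [prim, ← intervalIntegral.integral_const_mul, ← intervalIntegral.integral_sub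
      (hfi.const_mul t) hfs]
    congr 1; ext s; ring
  rw [h2, mul_comm t, ← h]
  simp [prim]

section Abstract

variable {X : Type*} [NormedAddCommGroup X] [InnerProductSpace ℝ X]

/-- Lions' projection argument: a linear functional `χ ↦ ⟪F, S χ⟫` that is controlled by `K` is
represented through `K`. -/
theorem exists_inner_eq_of_norm_le [CompleteSpace X] (K S : X →L[ℝ] X) (C : ℝ)
    (hKS : ∀ χ, ‖S χ‖ ≤ C * ‖K χ‖) (F : X) : ∃ z : X, ∀ χ, inner ℝ z (K χ) = inner ℝ F (S χ) := by
  let V : Submodule ℝ X := LinearMap.range K.toLinearMap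
  have hwd : ∀ χ₁ χ₂, K χ₁ = K χ₂ → S χ₁ = S χ₂ := fun χ₁ χ₂ h => by
    have := hKS (χ₁ - χ₂)
    rw [map_sub K, h, sub_self, norm_zero, mul_zero, map_sub] at this
    exact sub_eq_zero.1 (norm_le_zero_iff.1 this)
  choose pre hpre using fun y : V => y.2
  have hpre' : ∀ y : V, K (pre y) = y := hpre
  let φ : V →ₗ[ℝ] ℝ :=
    { toFun := fun y => inner ℝ F (S (pre y))
      map_add' := fun y₁ y₂ => by
        rw [← inner_add_right, ← map_add]
        exact congrArg _ (hwd _ _ (by simp [hpre']))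
      map_smul' := fun c y => by
        rw [RingHom.id_apply, smul_eq_mul, ← real_inner_smul_right, ← map_smul]
        exact congrArg _ (hwd _ _ (by simp [hpre'])) }
  let φc : StrongDual ℝ V := φ.mkContinuous (‖F‖ * C) fun y => by
    calc ‖inner ℝ F (S (pre y))‖ ≤ ‖F‖ * ‖S (pre y)‖ := norm_inner_le_norm _ _
      _ ≤ ‖F‖ * (C * ‖K (pre y)‖) := by gcongr; exact hKS _
      _ = ‖F‖ * C * ‖y‖ := by rw [hpre', mul_assoc]; rfl
  obtain ⟨g, hg, -⟩ := exists_extension_norm_eq V φc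
  refine ⟨(InnerProductSpace.toDual ℝ X).symm g, fun χ => ?_⟩
  rw [InnerProductSpace.toDual_symm_apply]
  have h := hg ⟨K χ, χ, rfl⟩
  rw [h]
  exact congrArg _ (hwd _ _ (hpre' _))

variable {J J' R D A : X →L[ℝ] X} {c : ℝ}

/-- Solvability of the time-integrated damped wave equation `R z + J (D z + A (J z)) = J F`. -/
theorem exists_integrated_solution [CompleteSpace X] (hc : 0 < c)
    (hJ : ∀ x y, inner ℝ (J x) y = inner ℝ x (J' y))
    (hR : ∀ x y, inner ℝ (R x) y = inner ℝ x (R y))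
    (hD : ∀ x y, inner ℝ (D x) y = inner ℝ x (D y))
    (hA : ∀ x y, inner ℝ (A x) y = inner ℝ x (A y))
    (hRJ : ∀ y, 0 ≤ inner ℝ (R y) (J' y)) (hDc : ∀ y, c * ‖y‖ ^ 2 ≤ inner ℝ (D y) y)
    (hAJ : ∀ y, 0 ≤ inner ℝ (A y) (J y)) (F : X) :
    ∃ z, R z + J (D z + A (J z)) = J F := by
  let K : X →L[ℝ] X := R + D.comp J' + J'.comp (A.comp J')
  have hK : ∀ χ, K χ = R χ + D (J' χ) + J' (A (J' χ)) := fun χ => rfl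
  have hb : ∀ χ, ‖J' χ‖ ≤ c⁻¹ * ‖K χ‖ := fun χ => by
    have h1 : c * ‖J' χ‖ ^ 2 ≤ inner ℝ (K χ) (J' χ) := by
      rw [hK, inner_add_left, inner_add_left]
      have h2 := hAJ (J' χ)
      have h3 : inner ℝ (J' (A (J' χ))) (J' χ) = inner ℝ (A (J' χ)) (J (J' χ)) := by
        rw [real_inner_comm, ← hJ, real_inner_comm]
      linarith [hRJ χ, hDc (J' χ)]
    have h2 := h1.trans (real_inner_le_norm _ _)
    rcases (norm_nonneg (J' χ)).eq_or_lt with h0 | h0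
    · rw [← h0]; positivity
    · rw [le_inv_mul_iff₀ hc]
      nlinarith
  obtain ⟨z, hz⟩ := exists_inner_eq_of_norm_le K J' c⁻¹ hb F
  refine ⟨z, ext_inner_right ℝ fun χ => ?_⟩
  rw [hJ F, ← hz χ, hK, inner_add_left, inner_add_right, inner_add_right, hR, hJ, inner_add_left, hD,
    hA, hJ, add_assoc]

/-- Uniqueness for the time-integrated damped wave equation. -/
theorem integral_eq_zero_of_integrated_solution (hc : 0 < c)
    (hA : ∀ x y, inner ℝ (A x) y = inner ℝ x (A y))
    (hJD : ∀ x, J (D x) = D (J x)) (hJA : ∀ x, J (A x) = A (J x))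
    (hRJ : ∀ y, 0 ≤ inner ℝ (R y) (J y)) (hDc : ∀ y, c * ‖y‖ ^ 2 ≤ inner ℝ (D y) y)
    (hAJ : ∀ y, 0 ≤ inner ℝ (A y) (J y)) {z : X} (hz : R z + J (D z + A (J z)) = 0) :
    J z = 0 := by
  have h := congrArg (fun y => inner ℝ y (J z)) hz
  simp only [inner_zero_left, map_add, hJD, hJA, inner_add_left] at h
  have h3 := hAJ (J z)
  rw [real_inner_comm, ← hA] at h3
  have h4 : ‖J z‖ ^ 2 ≤ 0 := by nlinarith [hRJ z, hDc (J z)]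
  exact norm_eq_zero.1 (pow_eq_zero_iff two_ne_zero |>.1 (le_antisymm h4 (sq_nonneg _)))

end Abstract

theorem UnitKernel.intFst_intFst_congr (l : UnitKernel) {α β : Measure ℝ} [IsFiniteMeasure α]
    [IsFiniteMeasure β] (f : Lp ℝ 2 (α.prod β)) :
    l.opFst α β (l.opFst α β f) =ᵐ[α.prod β] l.intFst α (l.intFst α f) :=
  (l.coeFn_opFst _).trans (l.intFst_congr (l.coeFn_opFst f))

theorem opFst_mulOp_comm (l : UnitKernel) {α β : Measure ℝ} [IsFiniteMeasure α] [IsFiniteMeasure β]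
    (m : ℝ → ℝ) (hm : MemLp (fun p : ℝ × ℝ => m p.2) ∞ (α.prod β)) (f : Lp ℝ 2 (α.prod β)) :
    l.opFst α β (mulOp _ hm f) = mulOp _ hm (l.opFst α β f) := by
  refine Lp.ext ?_
  refine ((l.coeFn_opFst _).trans (l.intFst_congr (coeFn_mulOp _ hm f))).trans ?_
  filter_upwards [coeFn_mulOp _ hm (l.opFst α β f), l.coeFn_opFst f] with p h1 h2
  rw [h1, h2]
  simp only [UnitKernel.intFst, ← integral_const_mul]
  congr 1; ext s; ring

section Rectangle

/-- Lebesgue measure on the rectangle `(0, L) × (0, T)`, as a product. -/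
noncomputable abbrev rect (L T : ℝ) : Measure (ℝ × ℝ) := (leb L).prod (leb T)

/-- Integration in the second variable. -/
noncomputable def timeInt (L T : ℝ) : Lp ℝ 2 (rect L T) →L[ℝ] Lp ℝ 2 (rect L T) :=
  UnitKernel.volterra.opSnd (leb L) (leb T)

/-- The adjoint of `timeInt`. -/
noncomputable def timeIntAdj (L T : ℝ) : Lp ℝ 2 (rect L T) →L[ℝ] Lp ℝ 2 (rect L T) :=
  UnitKernel.volterra.flip.opSnd (leb L) (leb T)

/-- Twofold integration in the first variable. -/
noncomputable def spaceInt (L T : ℝ) : Lp ℝ 2 (rect L T) →L[ℝ] Lp ℝ 2 (rect L T) :=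
  (UnitKernel.volterra.opFst (leb L) (leb T)).comp (UnitKernel.volterra.opFst (leb L) (leb T))

/-- The adjoint of `spaceInt`. -/
noncomputable def spaceIntAdj (L T : ℝ) : Lp ℝ 2 (rect L T) →L[ℝ] Lp ℝ 2 (rect L T) :=
  (UnitKernel.volterra.flip.opFst (leb L) (leb T)).comp
    (UnitKernel.volterra.flip.opFst (leb L) (leb T))

variable {L T : ℝ}

theorem ae_rect_mem (L T : ℝ) : ∀ᵐ p ∂(rect L T), p.1 ∈ Ioo 0 L ∧ p.2 ∈ Ioo 0 T :=
  (Measure.quasiMeasurePreserving_fst.ae (ae_leb_mem L)).and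
    (Measure.quasiMeasurePreserving_snd.ae (ae_leb_mem T))

theorem coeFn_timeInt (f : Lp ℝ 2 (rect L T)) :
    timeInt L T f =ᵐ[rect L T] fun p => prim (fun s => f (p.1, s)) p.2 := by
  filter_upwards [UnitKernel.volterra.coeFn_opSnd f, ae_rect_mem L T] with p hp hm
  refine hp.trans ?_
  exact integral_volterra (Ioo_subset_Icc_self hm.2) _

theorem coeFn_timeIntAdj (f : Lp ℝ 2 (rect L T)) :
    timeIntAdj L T f =ᵐ[rect L T] fun p => ∫ s in p.2..T, f (p.1, s) := by
  filter_upwards [UnitKernel.volterra.flip.coeFn_opSnd f, ae_rect_mem L T] with p hp hm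
  refine hp.trans ?_
  exact integral_volterra_flip (Ioo_subset_Icc_self hm.2) (fun s => f (p.1, s))

theorem coeFn_spaceInt (f : Lp ℝ 2 (rect L T)) :
    spaceInt L T f =ᵐ[rect L T] fun p => prim (prim fun y => f (y, p.2)) p.1 := by
  filter_upwards [UnitKernel.volterra.intFst_intFst_congr f, ae_rect_mem L T] with p hp hm
  refine hp.trans ?_
  refine (integral_volterra (Ioo_subset_Icc_self hm.1) _).trans ?_
  refine prim_congr_ae ?_ (Ioo_subset_Icc_self hm.1)
  filter_upwards [ae_leb_mem L] with x hx
  exact integral_volterra (Ioo_subset_Icc_self hx) _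

theorem inner_timeInt (f g : Lp ℝ 2 (rect L T)) :
    inner ℝ (timeInt L T f) g = inner ℝ f (timeIntAdj L T g) :=
  UnitKernel.inner_opSnd _ f g

theorem inner_spaceInt (f g : Lp ℝ 2 (rect L T)) :
    inner ℝ (spaceInt L T f) g = inner ℝ f (spaceIntAdj L T g) := by
  simp only [spaceInt, spaceIntAdj, ContinuousLinearMap.comp_apply, UnitKernel.inner_opFst]

theorem inner_spaceIntAdj (f g : Lp ℝ 2 (rect L T)) :
    inner ℝ (spaceIntAdj L T f) g = inner ℝ f (spaceInt L T g) := by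
  rw [real_inner_comm, ← inner_spaceInt, real_inner_comm]

theorem spaceInt_timeInt (f : Lp ℝ 2 (rect L T)) :
    spaceInt L T (timeInt L T f) = timeInt L T (spaceInt L T f) := by
  simp only [spaceInt, timeInt, ContinuousLinearMap.comp_apply, UnitKernel.opFst_opSnd_comm]

theorem spaceIntAdj_timeInt (f : Lp ℝ 2 (rect L T)) :
    spaceIntAdj L T (timeInt L T f) = timeInt L T (spaceIntAdj L T f) := by
  simp only [spaceIntAdj, timeInt, ContinuousLinearMap.comp_apply, UnitKernel.opFst_opSnd_comm]

theorem memLp_top_fst {m : ℝ → ℝ} (hm : MemLp m ∞ (leb L)) :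
    MemLp (fun p : ℝ × ℝ => m p.1) ∞ (rect L T) := hm.comp_fst _

theorem ae_slice_integrable {f : ℝ × ℝ → ℝ} (hf : MemLp f 2 (rect L T)) :
    ∀ᵐ x ∂(leb L), MemLp (fun t => f (x, t)) 2 (leb T) ∧ Integrable (fun t => f (x, t)) (leb T) :=
  (UnitKernel.memLp_slice hf).mono fun _ hx => ⟨hx, hx.integrable (by norm_num)⟩

/-- The cut-off in time at `s`. -/
noncomputable def cutoff (L T s : ℝ) : Lp ℝ 2 (rect L T) →L[ℝ] Lp ℝ 2 (rect L T) :=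
  mulOp (fun p : ℝ × ℝ => UnitKernel.volterra.toFun s p.2)
    (memLp_top_of_bound ((UnitKernel.volterra.meas.comp
      (by fun_prop : Measurable fun p : ℝ × ℝ => (s, p.2))).aestronglyMeasurable) 1
      (Filter.Eventually.of_forall fun _ => UnitKernel.volterra.bound _ _))

theorem spaceInt_cutoff (s : ℝ) (f : Lp ℝ 2 (rect L T)) :
    spaceInt L T (cutoff L T s f) = cutoff L T s (spaceInt L T f) := by
  simp only [spaceInt, cutoff, ContinuousLinearMap.comp_apply]
  rw [opFst_mulOp_comm _ (fun t => UnitKernel.volterra.toFun s t),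
    opFst_mulOp_comm _ (fun t => UnitKernel.volterra.toFun s t)]

/-- Integrals over the part of the rectangle before the time `s`. -/
theorem inner_cutoff {s : ℝ} (hs : s ∈ Icc 0 T) (f g : Lp ℝ 2 (rect L T)) :
    inner ℝ f (cutoff L T s g) = ∫ x, prim (fun t => f (x, t) * g (x, t)) s ∂(leb L) := by
  have h1 : inner ℝ f (cutoff L T s g)
      = ∫ p, UnitKernel.volterra.toFun s p.2 * (f p * g p) ∂(rect L T) := by
    rw [cutoff, ← inner_mulOp_comm, inner_mulOp]
    congr 1; ext p; ring
  have hi : Integrable (fun p => f p * g p) (rect L T) := (Lp.memLp f).integrable_mul (Lp.memLp g)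
  rw [h1, integral_prod (fun p : ℝ × ℝ => UnitKernel.volterra.toFun s p.2 * (f p * g p))]
  · exact integral_congr_ae (Filter.Eventually.of_forall fun x => integral_volterra hs _)
  · exact hi.bdd_mul (c := 1) ((UnitKernel.volterra.meas.comp
      (by fun_prop : Measurable fun p : ℝ × ℝ => (s, p.2))).aestronglyMeasurable)
      (Filter.Eventually.of_forall fun _ => UnitKernel.volterra.bound _ _)

theorem inner_mulOp_cutoff_timeInt {m : ℝ → ℝ} (hm : MemLp m ∞ (leb L)) {s : ℝ}
    (hs : s ∈ Icc 0 T) (f : Lp ℝ 2 (rect L T)) :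
    inner ℝ (mulOp _ (memLp_top_fst hm) f) (cutoff L T s (timeInt L T f))
      = ∫ x, m x * (prim (fun t => f (x, t)) s ^ 2 / 2) ∂(leb L) := by
  rw [inner_cutoff hs]
  refine integral_congr_ae ?_
  filter_upwards [ae_slice_integrable (Lp.memLp f), Measure.ae_ae_of_ae_prod (coeFn_timeInt f),
    Measure.ae_ae_of_ae_prod (coeFn_mulOp _ (memLp_top_fst (T := T) hm) f)] with x h1 h2 h3
  rw [← integral_mul_prim_self h1.2 hs, ← intervalIntegral.integral_const_mul]
  refine prim_congr_ae ?_ hs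
  filter_upwards [h2, h3] with t h2 h3
  rw [h2, h3]; ring

theorem cutoff_final (f : Lp ℝ 2 (rect L T)) : cutoff L T T f = f := by
  refine Lp.ext ((coeFn_mulOp _ _ f).trans ?_)
  filter_upwards [ae_rect_mem L T] with p hp
  simp [UnitKernel.volterra, hp.2.2]

theorem inner_mulOp_cutoff_timeInt_nonneg {m : ℝ → ℝ} (hm : MemLp m ∞ (leb L))
    (h0 : ∀ᵐ x ∂(leb L), 0 ≤ m x) {s : ℝ} (hs : s ∈ Icc 0 T) (f : Lp ℝ 2 (rect L T)) :
    0 ≤ inner ℝ (mulOp _ (memLp_top_fst hm) f) (cutoff L T s (timeInt L T f)) := by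
  rw [inner_mulOp_cutoff_timeInt hm hs]
  exact integral_nonneg_of_ae (h0.mono fun x hx => mul_nonneg hx (by positivity))

theorem inner_mulOp_timeInt_nonneg (hT : 0 ≤ T) {m : ℝ → ℝ} (hm : MemLp m ∞ (leb L))
    (h0 : ∀ᵐ x ∂(leb L), 0 ≤ m x) (f : Lp ℝ 2 (rect L T)) :
    0 ≤ inner ℝ (mulOp _ (memLp_top_fst hm) f) (timeInt L T f) := by
  have := inner_mulOp_cutoff_timeInt_nonneg hm h0 (⟨hT, le_rfl⟩ : T ∈ Icc 0 T) f
  rwa [cutoff_final] at this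

theorem inner_mulOp_cutoff_nonneg {m : ℝ → ℝ} (hm : MemLp m ∞ (leb L))
    (h0 : ∀ᵐ x ∂(leb L), 0 ≤ m x) (s : ℝ) (f : Lp ℝ 2 (rect L T)) :
    0 ≤ inner ℝ (mulOp _ (memLp_top_fst hm) f) (cutoff L T s f) := by
  rw [inner_mulOp]
  refine integral_nonneg_of_ae ?_
  filter_upwards [coeFn_mulOp _ _ f, Measure.quasiMeasurePreserving_fst.ae h0] with p h1 h2
  rw [cutoff, h1]
  have : 0 ≤ UnitKernel.volterra.toFun s p.2 := by
    simp only [UnitKernel.volterra]; split_ifs <;> norm_num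
  have := mul_nonneg (mul_nonneg h2 this) (mul_self_nonneg (f p))
  calc (0 : ℝ) ≤ _ := this
    _ = _ := by ring

theorem le_inner_mulOp {m : ℝ → ℝ} (hm : MemLp m ∞ (leb L)) {c : ℝ}
    (h0 : ∀ᵐ x ∂(leb L), c ≤ m x) (f : Lp ℝ 2 (rect L T)) :
    c * ‖f‖ ^ 2 ≤ inner ℝ (mulOp _ (memLp_top_fst hm) f) f := by
  rw [← real_inner_self_eq_norm_sq, inner_mulOp, inner_l2, ← integral_const_mul]
  have hi : Integrable (fun p => f p * f p) (rect L T) := (Lp.memLp f).integrable_mul (Lp.memLp f)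
  refine integral_mono_ae (hi.const_mul c) ?_ ?_
  · have := ((Lp.memLp (mulOp _ (memLp_top_fst (T := T) hm) f)).integrable_mul (Lp.memLp f))
    refine this.congr ?_
    filter_upwards [coeFn_mulOp _ (memLp_top_fst (T := T) hm) f] with p hp
    rw [Pi.mul_apply, hp]
  · filter_upwards [Measure.quasiMeasurePreserving_fst.ae h0] with p hp
    have := mul_le_mul_of_nonneg_right hp (mul_self_nonneg (f p))
    linarith

end Rectangle

section Slices

variable {L T : ℝ}

theorem prim_prim_comm {f : ℝ × ℝ → ℝ} (hf : Integrable f (rect L T)) {x t : ℝ}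
    (hx : x ∈ Icc 0 L) (ht : t ∈ Icc 0 T) :
    prim (fun y => prim (fun s => f (y, s)) t) x = prim (fun s => prim (fun y => f (y, s)) x) t := by
  have h1 : ∀ {a b : ℝ}, (∀ {g : ℝ → ℝ} (_ : a ∈ Icc 0 b), prim g a = ∫ y in Ioc 0 a, g y) :=
    fun {a b g} h => intervalIntegral.integral_of_le h.1
  simp only [h1 hx, h1 ht]
  refine integral_integral_swap (f := fun y s => f (y, s)) ?_
  rw [Measure.prod_restrict, ← Measure.volume_eq_prod]
  have h2 : IntegrableOn f (Ioc 0 L ×ˢ Ioc 0 T) := by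
    rw [IntegrableOn, Measure.volume_eq_prod, ← Measure.prod_restrict,
      ← restrict_Ioo_eq_restrict_Ioc, ← restrict_Ioo_eq_restrict_Ioc]
    exact hf
  exact h2.mono_set (prod_mono (Ioc_subset_Ioc_right hx.2) (Ioc_subset_Ioc_right ht.2))

theorem ae_slice_snd_integrable {f : ℝ × ℝ → ℝ} (hf : MemLp f 2 (rect L T)) :
    ∀ᵐ t ∂(leb T), MemLp (fun x => f (x, t)) 2 (leb L) ∧ Integrable (fun x => f (x, t)) (leb L) :=
  (UnitKernel.memLp_slice (hf.comp_measurePreserving Measure.measurePreserving_swap)).mono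
    fun _ hx => ⟨hx, hx.integrable (by norm_num)⟩

theorem ae_ae_snd {p : ℝ × ℝ → Prop} (h : ∀ᵐ q ∂(rect L T), p q) :
    ∀ᵐ t ∂(leb T), ∀ᵐ x ∂(leb L), p (x, t) :=
  Measure.ae_ae_of_ae_prod (Measure.measurePreserving_swap.quasiMeasurePreserving.ae h)

theorem memLp_prim_fst {f : ℝ × ℝ → ℝ} (hf : MemLp f 2 (rect L T)) :
    MemLp (fun p : ℝ × ℝ => prim (fun y => f (y, p.2)) p.1) 2 (rect L T) := by
  refine (memLp_congr_ae ?_).1 (UnitKernel.volterra.memLp_intFst hf)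
  filter_upwards [ae_rect_mem L T] with p hp
  exact integral_volterra (Ioo_subset_Icc_self hp.1) _

theorem memLp_prim_snd {f : ℝ × ℝ → ℝ} (hf : MemLp f 2 (rect L T)) :
    MemLp (fun p : ℝ × ℝ => prim (fun s => f (p.1, s)) p.2) 2 (rect L T) := by
  refine (memLp_congr_ae ?_).1 (UnitKernel.volterra.memLp_intSnd hf)
  filter_upwards [ae_rect_mem L T] with p hp
  exact integral_volterra (Ioo_subset_Icc_self hp.2) _

theorem prim_prim_prim_comm {f : ℝ × ℝ → ℝ} (hf : MemLp f 2 (rect L T)) {x t : ℝ}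
    (hx : x ∈ Icc 0 L) (ht : t ∈ Icc 0 T) :
    prim (fun s => prim (prim fun y => f (y, s)) x) t
      = prim (prim fun y => prim (fun s => f (y, s)) t) x := by
  rw [← prim_prim_comm (f := fun p : ℝ × ℝ => prim (fun y => f (y, p.2)) p.1)
    ((memLp_prim_fst hf).integrable (by norm_num)) hx ht]
  refine prim_congr_ae ?_ hx
  filter_upwards [ae_leb_mem L] with y hy
  exact (prim_prim_comm (hf.integrable (by norm_num)) (Ioo_subset_Icc_self hy) ht).symm

/-- The set where the difference quotients of `H(·, t)` with rational increments converge to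
`d` is measurable. -/
theorem measurableSet_rat_deriv {H d : ℝ × ℝ → ℝ} (hH : Measurable H) (hd : Measurable d) :
    MeasurableSet {p : ℝ × ℝ | ∀ n : ℕ, ∃ k : ℕ, ∀ h : ℚ, |(h : ℝ)| < 1 / (k + 1) →
      |H (p.1 + h, p.2) - H p - h * d p| ≤ 1 / (n + 1) * |(h : ℝ)|} := by
  have e : {p : ℝ × ℝ | ∀ n : ℕ, ∃ k : ℕ, ∀ h : ℚ, |(h : ℝ)| < 1 / (k + 1) →
      |H (p.1 + h, p.2) - H p - h * d p| ≤ 1 / (n + 1) * |(h : ℝ)|}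
      = ⋂ n : ℕ, ⋃ k : ℕ, ⋂ h : ℚ, ⋂ _ : |(h : ℝ)| < 1 / (k + 1),
        {p : ℝ × ℝ | |H (p.1 + h, p.2) - H p - h * d p| ≤ 1 / (n + 1) * |(h : ℝ)|} := by
    ext p; simp
  rw [e]
  refine .iInter fun n => .iUnion fun k => .iInter fun h => .iInter fun _ => ?_
  refine measurableSet_le ?_ measurable_const
  have h1 : Measurable fun p : ℝ × ℝ => H (p.1 + h, p.2) := hH.comp (by fun_prop)
  have h2 : Measurable fun p : ℝ × ℝ => H (p.1 + h, p.2) - H p - h * d p := by fun_prop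
  exact h2.norm

theorem hasDerivAt_of_rat {H : ℝ → ℝ} {x d L : ℝ} (hx : x ∈ Ioo 0 L) (hc : ContinuousOn H (Icc 0 L))
    (h : ∀ n : ℕ, ∃ k : ℕ, ∀ h : ℚ, |(h : ℝ)| < 1 / (k + 1) →
      |H (x + h) - H x - h * d| ≤ 1 / (n + 1) * |(h : ℝ)|) : HasDerivAt H d x := by
  rw [hasDerivAt_iff_isLittleO_nhds_zero, Asymptotics.isLittleO_iff]
  intro c hc0
  obtain ⟨n, hn⟩ := exists_nat_one_div_lt hc0
  obtain ⟨k, hk⟩ := h n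
  have hU : {e : ℝ | |e| < 1 / (k + 1) ∧ x + e ∈ Ioo 0 L} ∈ nhds (0 : ℝ) := by
    refine IsOpen.mem_nhds (IsOpen.and ?_ ?_) ⟨?_, ?_⟩
    · exact isOpen_lt continuous_abs continuous_const
    · exact isOpen_Ioo.preimage (continuous_const.add continuous_id)
    · rw [abs_zero]; positivity
    · simpa using hx
  have hUo : IsOpen {e : ℝ | |e| < 1 / ((k : ℝ) + 1) ∧ x + e ∈ Ioo 0 L} :=
    IsOpen.and (isOpen_lt continuous_abs continuous_const)
      (isOpen_Ioo.preimage (continuous_const.add continuous_id))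
  filter_upwards [hU] with e he
  have hce : ContinuousAt (fun e : ℝ => c * |e| - |H (x + e) - H x - e * d|) e := by
    have : ContinuousAt (fun e : ℝ => H (x + e)) e :=
      ContinuousAt.comp (f := fun e : ℝ => x + e)
        (hc.continuousAt (Icc_mem_nhds he.2.1 he.2.2)) (by fun_prop)
    exact (continuous_const.mul continuous_abs).continuousAt.sub
      ((this.sub continuousAt_const).sub (by fun_prop)).abs
  have hfreq : ∃ᶠ e' in nhds e, 0 ≤ c * |e'| - |H (x + e') - H x - e' * d| := by
    rw [frequently_nhds_iff]
    intro U heU hUo'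
    obtain ⟨q, hq⟩ := Rat.denseRange_cast (𝕜 := ℝ).exists_mem_open (hUo'.inter hUo) ⟨e, heU, he⟩
    refine ⟨q, hq.1, ?_⟩
    have := hk q hq.2.1
    have h3 : 1 / ((n : ℝ) + 1) * |(q : ℝ)| ≤ c * |(q : ℝ)| := by gcongr
    linarith
  have := ge_of_tendsto_of_frequently hce.tendsto hfreq
  simpa [smul_eq_mul] using this

/-- The derivative in the first variable of a partial primitive, almost everywhere in the
rectangle. -/
theorem ae_hasDerivAt_prim_fst (hL : 0 ≤ L) {f : ℝ × ℝ → ℝ} (hf : MemLp f 2 (rect L T)) :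
    ∀ᵐ p ∂(rect L T), HasDerivAt (prim fun y => f (y, p.2)) (f p) p.1 := by
  set f₀ := hf.1.mk f with hf₀
  have hf₀m : StronglyMeasurable f₀ := hf.1.stronglyMeasurable_mk
  have hfe : f =ᵐ[rect L T] f₀ := hf.1.ae_eq_mk
  set H : ℝ × ℝ → ℝ := UnitKernel.volterra.intFst (leb L) f₀ with hH
  have hHm : Measurable H := by
    have : StronglyMeasurable (fun q : (ℝ × ℝ) × ℝ =>
        UnitKernel.volterra.toFun q.1.1 q.2 * f₀ (q.2, q.1.2)) := by
      refine StronglyMeasurable.mul ?_ ?_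
      · exact (UnitKernel.volterra.meas.comp
          (by fun_prop : Measurable fun q : (ℝ × ℝ) × ℝ => (q.1.1, q.2))).stronglyMeasurable
      · exact hf₀m.comp_measurable (by fun_prop)
    exact this.integral_prod_right'.measurable
  have hHp : ∀ t, ∀ x ∈ Icc 0 L, H (x, t) = prim (fun y => f₀ (y, t)) x :=
    fun t x hx => integral_volterra hx _
  have hgood : ∀ᵐ t ∂(leb T), Integrable (fun y => f₀ (y, t)) (leb L) :=
    (ae_slice_snd_integrable ((memLp_congr_ae hfe).1 hf)).mono fun t ht => ht.2
  have hS := measurableSet_rat_deriv hHm hf₀m.measurable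
  have h1 : ∀ᵐ p ∂(rect L T), ∀ n : ℕ, ∃ k : ℕ, ∀ h : ℚ, |(h : ℝ)| < 1 / (k + 1) →
      |H (p.1 + h, p.2) - H p - h * f₀ p| ≤ 1 / (n + 1) * |(h : ℝ)| := by
    have h2 : ∀ᵐ t ∂(leb T), ∀ᵐ x ∂(leb L), (x, t) ∈ {p : ℝ × ℝ | ∀ n : ℕ, ∃ k : ℕ, ∀ h : ℚ,
        |(h : ℝ)| < 1 / (k + 1) → |H (p.1 + h, p.2) - H p - h * f₀ p| ≤ 1 / (n + 1) * |(h : ℝ)|} := by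
      filter_upwards [hgood] with t ht
      filter_upwards [ae_hasDerivAt_prim hL ht, ae_leb_mem L] with x hx hxm n
      have hx' : HasDerivAt (fun x => H (x, t)) (f₀ (x, t)) x :=
        hx.congr_of_eventuallyEq (Filter.mem_of_superset (Icc_mem_nhds hxm.1 hxm.2)
          fun y hy => hHp t y hy)
      rw [hasDerivAt_iff_isLittleO_nhds_zero, Asymptotics.isLittleO_iff] at hx'
      obtain ⟨ε, hε, hx''⟩ := Metric.eventually_nhds_iff.1
        (hx' (c := 1 / (n + 1)) (by positivity))
      obtain ⟨k, hk⟩ := exists_nat_one_div_lt hε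
      refine ⟨k, fun h hh => ?_⟩
      have := hx'' (y := (h : ℝ)) (by rw [Real.dist_eq, sub_zero]; exact hh.trans hk)
      rw [Real.norm_eq_abs, Real.norm_eq_abs, smul_eq_mul] at this
      exact this
    have h3 := (Measure.ae_prod_iff_ae_ae (μ := leb T) (ν := leb L)
      (p := fun q => (q.2, q.1) ∈ {p : ℝ × ℝ | ∀ n : ℕ, ∃ k : ℕ, ∀ h : ℚ,
        |(h : ℝ)| < 1 / (k + 1) → |H (p.1 + h, p.2) - H p - h * f₀ p| ≤ 1 / (n + 1) * |(h : ℝ)|})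
      (measurable_swap hS)).2 h2
    exact Measure.measurePreserving_swap.quasiMeasurePreserving.ae h3
  have hsl : ∀ᵐ p ∂(rect L T), (fun y => f (y, p.2)) =ᵐ[leb L] fun y => f₀ (y, p.2) :=
    Measure.quasiMeasurePreserving_snd.ae (ae_ae_snd hfe)
  filter_upwards [h1, ae_rect_mem L T, Measure.quasiMeasurePreserving_snd.ae hgood, hfe, hsl]
    with p hp hpm hpi hpe hps
  have hc : ContinuousOn (fun x => H (x, p.2)) (Icc 0 L) :=
    (continuousOn_prim hpi).congr fun x hx => hHp _ x hx
  have := hasDerivAt_of_rat hpm.1 hc hp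
  rw [hpe]
  refine this.congr_of_eventuallyEq (Filter.mem_of_superset (Icc_mem_nhds hpm.1.1 hpm.1.2) fun y hy => ?_)
  change _ = _
  rw [prim_congr_ae hps hy]
  exact (hHp _ y hy).symm

variable {f : ℝ × ℝ → ℝ} {U : ℝ → ℝ → ℝ}

/-- The second spatial derivative of a function given by its double primitives. -/
theorem ae_dOn_dOn_eq (hL : 0 < L) (hf : MemLp f 2 (rect L T))
    (hU : ∀ᵐ t ∂(leb T), ∀ x ∈ Icc 0 L, U x t = prim (prim fun y => f (y, t)) x) :
    (fun p : ℝ × ℝ => dOn L (dOn L (fun y => U y p.2)) p.1) =ᵐ[rect L T] f := by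
  filter_upwards [ae_hasDerivAt_prim_fst hL.le hf, ae_rect_mem L T,
    Measure.quasiMeasurePreserving_snd.ae (hU.and (ae_slice_snd_integrable hf))] with p h1 h2 h3
  rw [dOn_congr (fun y hy => (dOn_of_eq_prim_prim hL h3.2.2 h3.1 hy).2)
    (Ioo_subset_Icc_self h2.1), derivWithin_Icc_eq_deriv h2.1, h1.deriv]

end Slices

theorem Beam.lebΩ_eq (B : Beam) : B.lebΩ = rect B.len B.T := by
  rw [Beam.lebΩ, rect, leb, leb, Measure.prod_restrict, Measure.volume_eq_prod]

/-- Membership in `L²(0, T; V)` of a function given by double primitives in space. -/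
theorem Beam.memL2V_of_eq_prim_prim {B : Beam} (hL : 0 < B.len) {f : ℝ × ℝ → ℝ} {U : ℝ → ℝ → ℝ}
    (hf : MemLp f 2 (rect B.len B.T))
    (hU : ∀ᵐ t ∂(leb B.T), ∀ x ∈ Icc 0 B.len, U x t = prim (prim fun y => f (y, t)) x) :
    B.MemL2V U where
  mem_V := by
    filter_upwards [hU, ae_slice_snd_integrable hf] with t h1 h2
    exact memV_of_eq_prim_prim hL h2.1 h1
  memLp := by
    rw [B.lebΩ_eq]
    refine (memLp_congr_ae ?_).2 (memLp_prim_fst (memLp_prim_fst hf))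
    filter_upwards [Measure.quasiMeasurePreserving_snd.ae hU, ae_rect_mem B.len B.T] with p h1 h2
    exact h1 _ (Ioo_subset_Icc_self h2.1)
  memLp_dx := by
    rw [B.lebΩ_eq]
    refine (memLp_congr_ae ?_).2 (memLp_prim_fst hf)
    filter_upwards [Measure.quasiMeasurePreserving_snd.ae (hU.and (ae_slice_snd_integrable hf)),
      ae_rect_mem B.len B.T] with p h1 h2
    exact (dOn_of_eq_prim_prim hL h1.2.2 h1.1 (Ioo_subset_Icc_self h2.1)).2
  memLp_dxx := by
    rw [B.lebΩ_eq]
    exact (memLp_congr_ae (ae_dOn_dOn_eq hL hf hU)).2 hf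

/-- A square integrable function on a rectangle that is orthogonal to all products of a square
integrable function of `x` and a smooth function of `t` vanishes. -/
theorem eq_zero_of_integral_tensor {L T : ℝ} {Y : ℝ × ℝ → ℝ} (hY : MemLp Y 2 (rect L T))
    (h : ∀ z : ℝ → ℝ, MemLp z 2 (leb L) → ∀ η : ℝ → ℝ, ContDiff ℝ ∞ η →
      ∫ p, Y p * (z p.1 * η p.2) ∂(rect L T) = 0) : Y =ᵐ[rect L T] 0 := by
  have hYi := hY.integrable (q := 2) (by norm_num)
  have hrect : ∀ A B : Set ℝ, MeasurableSet A → MeasurableSet B →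
      ∫ p in A ×ˢ B, Y p ∂(rect L T) = 0 := by
    intro A B hA hB
    have hAi : Integrable (fun p : ℝ × ℝ => A.indicator 1 p.1 * Y p) (rect L T) := by
      refine hYi.bdd_mul (c := 1) ((measurable_one.indicator hA).comp measurable_fst).aestronglyMeasurable
        (Filter.Eventually.of_forall fun p => ?_)
      simp only [indicator]; split_ifs <;> simp
    have h0 : ∀ᵐ t ∂(leb T), (∫ x, A.indicator 1 x * Y (x, t) ∂(leb L)) = 0 := by
      refine ae_eq_zero_of_integral_contDiff_smul_eq_zero hAi.integral_prod_right.locallyIntegrable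
        fun η hη hηc => ?_
      have h1 := h (A.indicator 1) (memLp_indicator_const 2 hA 1 (Or.inr (measure_ne_top _ _))) η hη
      obtain ⟨C, hC⟩ := hηc.exists_bound_of_continuous hη.continuous
      have hi : Integrable (fun p : ℝ × ℝ => η p.2 * (A.indicator 1 p.1 * Y p)) (rect L T) :=
        hAi.bdd_mul (c := C) (hη.continuous.comp continuous_snd).aestronglyMeasurable
          (Filter.Eventually.of_forall fun p => hC _)
      have h2 : ∫ p, η p.2 * (A.indicator 1 p.1 * Y p) ∂(rect L T) = 0 := by
        rw [← h1]; congr 1; ext p; ring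
      rw [integral_prod_symm _ hi] at h2
      simpa only [smul_eq_mul, integral_const_mul] using h2
    have h3 : ∫ p in A ×ˢ B, Y p ∂(rect L T)
        = ∫ t in B, ∫ x, A.indicator 1 x * Y (x, t) ∂(leb L) ∂(leb T) := by
      rw [rect, ← Measure.prod_restrict, integral_prod_symm]
      · refine integral_congr_ae (Filter.Eventually.of_forall fun t => ?_)
        simp only
        rw [← integral_indicator hA]
        congr 1; ext x
        by_cases hx : x ∈ A <;> simp [hx]
      · rw [Measure.prod_restrict]; exact hYi.integrableOn
    rw [h3]
    exact integral_eq_zero_of_ae (ae_restrict_of_ae h0)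
  have hall : ∀ s, MeasurableSet s → ∫ p in s, Y p ∂(rect L T) = 0 := by
    intro s hs
    induction s, hs using MeasurableSpace.induction_on_inter (generateFrom_prod (α := ℝ) (β := ℝ)).symm
      isPiSystem_prod with
    | empty => simp
    | basic s hs =>
      obtain ⟨A, hA, B, hB, rfl⟩ := hs
      exact hrect A B hA hB
    | compl s hs ih =>
      have h1 := integral_add_compl hs hYi
      have h2 := hrect univ univ .univ .univ
      rw [univ_prod_univ, setIntegral_univ] at h2
      linarith
    | iUnion s hd hs ih =>
      rw [integral_iUnion hs hd hYi.integrableOn]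
      simp [ih]
  exact hYi.ae_eq_zero_of_forall_setIntegral_eq_zero fun s hs _ => hall s hs

theorem memLp_tensor {L T : ℝ} {w η : ℝ → ℝ} (hw : MemLp w 2 (leb L)) (hη : MemLp η 2 (leb T)) :
    MemLp (fun p : ℝ × ℝ => w p.1 * η p.2) 2 (rect L T) := by
  have hm : AEStronglyMeasurable (fun p : ℝ × ℝ => w p.1 * η p.2) (rect L T) :=
    hw.1.comp_fst.mul hη.1.comp_snd
  rw [memLp_two_iff_integrable_sq hm]
  refine (hw.integrable_sq.mul_prod hη.integrable_sq).congr
    (Filter.Eventually.of_forall fun p => ?_)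
  simp only [mul_pow]

theorem prim_mul_const (f : ℝ → ℝ) (c x : ℝ) : prim (fun y => f y * c) x = prim f x * c :=
  intervalIntegral.integral_mul_const c f

theorem MemV.memLp {L : ℝ} {w : ℝ → ℝ} (hw : MemV L w) : MemLp (dOn L (dOn L w)) 2 (leb L) :=
  hw.1.2.2

theorem memLp_of_continuous {T : ℝ} {η : ℝ → ℝ} (hη : Continuous η) : MemLp η 2 (leb T) := by
  obtain ⟨C, hC⟩ := isCompact_Icc.exists_bound_of_continuousOn (s := Icc 0 T) hη.continuousOn
  exact MemLp.of_bound hη.aestronglyMeasurable C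
    ((ae_leb_mem T).mono fun t ht => hC t (Ioo_subset_Icc_self ht))

namespace Beam

variable {B : Beam}

/-- The operator `P* m P`, where `P` is the twofold integration in space. -/
noncomputable def massOp (B : Beam) (m : ℝ → ℝ) (hm : MemLp m ∞ (leb B.len)) :
    Lp ℝ 2 (rect B.len B.T) →L[ℝ] Lp ℝ 2 (rect B.len B.T) :=
  (spaceIntAdj B.len B.T).comp ((mulOp _ (memLp_top_fst hm)).comp (spaceInt B.len B.T))

theorem inner_massOp {m : ℝ → ℝ} (hm : MemLp m ∞ (leb B.len)) (y z : Lp ℝ 2 (rect B.len B.T)) :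
    inner ℝ (B.massOp m hm y) z
      = inner ℝ (mulOp _ (memLp_top_fst hm) (spaceInt B.len B.T y)) (spaceInt B.len B.T z) :=
  inner_spaceIntAdj _ _

theorem inner_massOp_comm {m : ℝ → ℝ} (hm : MemLp m ∞ (leb B.len))
    (y z : Lp ℝ 2 (rect B.len B.T)) :
    inner ℝ (B.massOp m hm y) z = inner ℝ y (B.massOp m hm z) := by
  rw [real_inner_comm (B.massOp m hm z), inner_massOp, inner_massOp, inner_mulOp_comm,
    real_inner_comm]

theorem timeInt_massOp {m : ℝ → ℝ} (hm : MemLp m ∞ (leb B.len)) (y : Lp ℝ 2 (rect B.len B.T)) :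
    timeInt B.len B.T (B.massOp m hm y) = B.massOp m hm (timeInt B.len B.T y) := by
  simp only [massOp, ContinuousLinearMap.comp_apply]
  rw [← spaceIntAdj_timeInt, spaceInt_timeInt, timeInt, opSnd_mulOp_comm]

variable (hB : B.BasicConditions)

/-- The operator of the damping terms. -/
noncomputable def dampOp : Lp ℝ 2 (rect B.len B.T) →L[ℝ] Lp ℝ 2 (rect B.len B.T) :=
  B.massOp B.μ hB.μ_mem + mulOp _ (memLp_top_fst hB.κ_mem)

/-- The operator of the elastic term. -/
noncomputable def stiffOp : Lp ℝ 2 (rect B.len B.T) →L[ℝ] Lp ℝ 2 (rect B.len B.T) :=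
  mulOp _ (memLp_top_fst hB.r_mem)

/-- The beam operator, integrated once in time, in terms of `z = v_xx` with `v = u_t`. -/
noncomputable def beamOp : Lp ℝ 2 (rect B.len B.T) →L[ℝ] Lp ℝ 2 (rect B.len B.T) :=
  B.massOp B.ρ hB.ρ_mem
    + (timeInt B.len B.T).comp (dampOp hB + (stiffOp hB).comp (timeInt B.len B.T))

theorem beamOp_apply (z : Lp ℝ 2 (rect B.len B.T)) : beamOp hB z = B.massOp B.ρ hB.ρ_mem z
    + timeInt B.len B.T (dampOp hB z + stiffOp hB (timeInt B.len B.T z)) := rfl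

theorem inner_dampOp_comm (y z : Lp ℝ 2 (rect B.len B.T)) :
    inner ℝ (dampOp hB y) z = inner ℝ y (dampOp hB z) := by
  simp only [dampOp, add_apply, inner_add_left, inner_add_right]
  rw [inner_massOp_comm, inner_mulOp_comm]

theorem timeInt_dampOp (y : Lp ℝ 2 (rect B.len B.T)) :
    timeInt B.len B.T (dampOp hB y) = dampOp hB (timeInt B.len B.T y) := by
  simp only [dampOp, add_apply, map_add]
  rw [timeInt_massOp, timeInt, opSnd_mulOp_comm]

theorem timeInt_stiffOp (y : Lp ℝ 2 (rect B.len B.T)) :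
    timeInt B.len B.T (stiffOp hB y) = stiffOp hB (timeInt B.len B.T y) := by
  rw [stiffOp, timeInt, opSnd_mulOp_comm]

include hB in
theorem BasicConditions.ρ_nonneg : ∀ᵐ x ∂(leb B.len), 0 ≤ B.ρ x :=
  hB.ρ_bounds.mono fun _ hx => hB.ρ₀_pos.le.trans hx.1

include hB in
theorem BasicConditions.μ_nonneg : ∀ᵐ x ∂(leb B.len), 0 ≤ B.μ x :=
  hB.μ_bounds.mono fun _ hx => hB.μ₀_nonneg.trans hx.1

include hB in
theorem BasicConditions.κ_nonneg : ∀ᵐ x ∂(leb B.len), 0 ≤ B.κ x :=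
  hB.κ_bounds.mono fun _ hx => hB.κ₀_pos.le.trans hx.1

include hB in
theorem BasicConditions.r_nonneg : ∀ᵐ x ∂(leb B.len), 0 ≤ B.r x :=
  hB.r_bounds.mono fun _ hx => hB.r₀_pos.le.trans hx.1

theorem le_inner_dampOp (y : Lp ℝ 2 (rect B.len B.T)) :
    B.κ₀ * ‖y‖ ^ 2 ≤ inner ℝ (dampOp hB y) y := by
  simp only [dampOp, add_apply, inner_add_left, inner_massOp]
  have h1 := le_inner_mulOp hB.μ_mem hB.μ_nonneg (spaceInt B.len B.T y)
  have h2 := le_inner_mulOp hB.κ_mem (hB.κ_bounds.mono fun _ hx => hx.1) y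
  linarith

theorem inner_stiffOp_timeInt_nonneg (y : Lp ℝ 2 (rect B.len B.T)) :
    0 ≤ inner ℝ (stiffOp hB y) (timeInt B.len B.T y) :=
  inner_mulOp_timeInt_nonneg hB.T_pos.le hB.r_mem hB.r_nonneg y

theorem inner_massOp_timeInt_nonneg (y : Lp ℝ 2 (rect B.len B.T)) :
    0 ≤ inner ℝ (B.massOp B.ρ hB.ρ_mem y) (timeInt B.len B.T y) := by
  rw [inner_massOp, spaceInt_timeInt]
  exact inner_mulOp_timeInt_nonneg hB.T_pos.le hB.ρ_mem hB.ρ_nonneg _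

theorem inner_massOp_timeIntAdj_nonneg (y : Lp ℝ 2 (rect B.len B.T)) :
    0 ≤ inner ℝ (B.massOp B.ρ hB.ρ_mem y) (timeIntAdj B.len B.T y) := by
  have h := inner_massOp_timeInt_nonneg hB y
  rwa [inner_massOp_comm, ← timeInt_massOp, real_inner_comm, inner_timeInt] at h

theorem exists_beamOp_eq (F : Lp ℝ 2 (rect B.len B.T)) :
    ∃ z, beamOp hB z = timeInt B.len B.T F :=
  exists_integrated_solution hB.κ₀_pos inner_timeInt (inner_massOp_comm hB.ρ_mem)
    (inner_dampOp_comm hB) (inner_mulOp_comm _ _) (inner_massOp_timeIntAdj_nonneg hB)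
    (le_inner_dampOp hB) (inner_stiffOp_timeInt_nonneg hB) F

theorem timeInt_eq_zero_of_beamOp {z : Lp ℝ 2 (rect B.len B.T)} (hz : beamOp hB z = 0) :
    timeInt B.len B.T z = 0 :=
  integral_eq_zero_of_integrated_solution hB.κ₀_pos (inner_mulOp_comm _ _)
    (timeInt_dampOp hB) (timeInt_stiffOp hB) (inner_massOp_timeInt_nonneg hB)
    (le_inner_dampOp hB) (inner_stiffOp_timeInt_nonneg hB) hz

theorem timeInt_beamOp (z : Lp ℝ 2 (rect B.len B.T)) :
    timeInt B.len B.T (beamOp hB z) = beamOp hB (timeInt B.len B.T z) := by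
  simp only [beamOp_apply, map_add, timeInt_massOp, timeInt_dampOp, timeInt_stiffOp]

/-- The lever arm of the boundary forces: `∫ leverArm · w'' = w(ℓ) + c w'(ℓ)` for `w ∈ V`. -/
noncomputable def leverArm (B : Beam) (x : ℝ) : ℝ := (B.len - x) + B.momentFactor

theorem continuous_leverArm (B : Beam) : Continuous B.leverArm := by
  unfold leverArm; fun_prop

theorem integral_leverArm_mul {z : ℝ → ℝ} (hL : 0 ≤ B.len) (hz : Integrable z (leb B.len)) :
    ∫ x, B.leverArm x * z x ∂(leb B.len)
      = prim (prim z) B.len + B.momentFactor * prim z B.len := by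
  have hm : B.len ∈ Icc 0 B.len := ⟨hL, le_rfl⟩
  have hz' := (integrable_leb_iff hL z).1 hz
  rw [integral_leb hL, prim_prim hz hm, prim, ← intervalIntegral.integral_const_mul,
    ← intervalIntegral.integral_add (hz'.continuousOn_mul (by fun_prop)) (hz'.const_mul _)]
  congr 1; ext x; rw [leverArm]; ring

/-- The density of the boundary forces. -/
noncomputable def force (B : Beam) (g : ℝ → ℝ) (hg : MemLp g 2 (leb B.T)) :
    Lp ℝ 2 (rect B.len B.T) :=
  (memLp_tensor (memLp_of_continuous B.continuous_leverArm) hg).toLp _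

theorem coeFn_force {g : ℝ → ℝ} (hg : MemLp g 2 (leb B.T)) :
    B.force g hg =ᵐ[rect B.len B.T] fun p => B.leverArm p.1 * g p.2 :=
  MemLp.coeFn_toLp _

/-- The test function in `L²` that belongs to `w ∈ V` and `φ`. -/
noncomputable def testFn (B : Beam) {w φ : ℝ → ℝ} (hw : MemV B.len w) (hφ : ContDiff ℝ ∞ φ) :
    Lp ℝ 2 (rect B.len B.T) :=
  (memLp_tensor hw.memLp (memLp_of_continuous (T := B.T)
    (hφ.continuous_deriv (by norm_num)).neg)).toLp _

section TestFunctions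

variable {w φ : ℝ → ℝ} (hw : MemV B.len w) (hφ : ContDiff ℝ ∞ φ)

theorem coeFn_testFn : B.testFn hw hφ =ᵐ[rect B.len B.T]
    fun p => dOn B.len (dOn B.len w) p.1 * -deriv φ p.2 :=
  MemLp.coeFn_toLp _

theorem coeFn_spaceInt_of_tensor {f : Lp ℝ 2 (rect B.len B.T)} {η : ℝ → ℝ}
    (hf : f =ᵐ[rect B.len B.T] fun p => dOn B.len (dOn B.len w) p.1 * η p.2) (hw : MemV B.len w) :
    spaceInt B.len B.T f =ᵐ[rect B.len B.T] fun p => w p.1 * η p.2 := by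
  filter_upwards [coeFn_spaceInt f, ae_rect_mem B.len B.T,
    Measure.quasiMeasurePreserving_snd.ae (ae_ae_snd hf)] with p h1 h2 h3
  have hp := Ioo_subset_Icc_self h2.1
  rw [h1, hw.eq_prim hp, ← prim_mul_const]
  refine prim_congr_ae ?_ hp
  filter_upwards [ae_leb_mem B.len] with y hy
  rw [← prim_mul_const]
  exact prim_congr_ae h3 (Ioo_subset_Icc_self hy)

theorem coeFn_timeIntAdj_testFn (hφT : φ B.T = 0) :
    timeIntAdj B.len B.T (B.testFn hw hφ) =ᵐ[rect B.len B.T]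
      fun p => dOn B.len (dOn B.len w) p.1 * φ p.2 := by
  filter_upwards [coeFn_timeIntAdj (B.testFn hw hφ), ae_rect_mem B.len B.T,
    Measure.quasiMeasurePreserving_fst.ae (Measure.ae_ae_of_ae_prod (coeFn_testFn hw hφ))]
    with p h1 h2 h3
  rw [h1]
  have h4 : ∫ s in p.2..B.T, B.testFn hw hφ (p.1, s)
      = ∫ s in p.2..B.T, dOn B.len (dOn B.len w) p.1 * -deriv φ s := by
    have hm := Ioo_subset_Icc_self h2.2
    rw [← integral_volterra_flip hm, ← integral_volterra_flip hm]
    refine integral_congr_ae ?_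
    filter_upwards [h3] with s hs
    rw [hs]
  rw [h4, intervalIntegral.integral_const_mul, intervalIntegral.integral_neg,
    intervalIntegral.integral_deriv_eq_sub (fun x _ => hφ.contDiffAt.differentiableAt (by simp))
      ((hφ.continuous_deriv (by norm_num)).intervalIntegrable _ _), hφT]
  ring

theorem integrable_mulOp_mul {m : ℝ → ℝ} (hm : MemLp m ∞ (leb B.len))
    (f g : Lp ℝ 2 (rect B.len B.T)) :
    Integrable (fun p => m p.1 * f p * g p) (rect B.len B.T) := by
  refine ((Lp.memLp (mulOp _ (memLp_top_fst (T := B.T) hm) f)).integrable_mul (Lp.memLp g)).congr ?_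
  filter_upwards [coeFn_mulOp _ (memLp_top_fst (T := B.T) hm) f] with p hp
  rw [Pi.mul_apply, hp]

/-- The weak form of the beam equation is the equation `beamOp z = timeInt force`, tested with
`testFn`. -/
theorem weak_form_iff {g : ℝ → ℝ} (hg : MemLp g 2 (leb B.T)) (hφT : φ B.T = 0)
    {z : Lp ℝ 2 (rect B.len B.T)} {v dv du : ℝ × ℝ → ℝ}
    (hv : v =ᵐ[rect B.len B.T] spaceInt B.len B.T z) (hdv : dv =ᵐ[rect B.len B.T] z)
    (hdu : du =ᵐ[rect B.len B.T] timeInt B.len B.T z) :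
    ∫ p : ℝ × ℝ, (-(B.ρ p.1 * v p * w p.1 * deriv φ p.2) + B.μ p.1 * v p * w p.1 * φ p.2
        + (B.r p.1 * du p + B.κ p.1 * dv p) * dOn B.len (dOn B.len w) p.1 * φ p.2) ∂B.lebΩ
      = ∫ t, (g t * w B.len + B.momentFactor * g t * dOn B.len w B.len) * φ t ∂(leb B.T)
    ↔ inner ℝ (beamOp hB z - timeInt B.len B.T (B.force g hg)) (B.testFn hw hφ) = 0 := by
  set χ := B.testFn hw hφ with hχ
  set P := spaceInt B.len B.T with hP
  set ψ := timeIntAdj B.len B.T χ with hψ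
  have hχe := coeFn_testFn hw hφ
  have hPχ := coeFn_spaceInt_of_tensor (η := fun t => -deriv φ t) hχe hw
  have hψe := coeFn_timeIntAdj_testFn hw hφ hφT
  have hPψ := coeFn_spaceInt_of_tensor (η := φ) hψe hw
  have hL := hB.len_pos.le
  have hlen : B.len ∈ Icc 0 B.len := ⟨hL, le_rfl⟩
  have hF : inner ℝ (timeInt B.len B.T (B.force g hg)) χ
      = ∫ t, (g t * w B.len + B.momentFactor * g t * dOn B.len w B.len) * φ t ∂(leb B.T) := by
    rw [inner_timeInt, inner_l2]
    have e1 : ∫ p, B.force g hg p * ψ p ∂(rect B.len B.T)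
        = ∫ p : ℝ × ℝ, (B.leverArm p.1 * dOn B.len (dOn B.len w) p.1) * (g p.2 * φ p.2)
            ∂(rect B.len B.T) := by
      refine integral_congr_ae ?_
      filter_upwards [coeFn_force hg, hψe] with p h1 h2
      rw [h1, h2]; ring
    rw [e1, integral_prod_mul (fun x => B.leverArm x * dOn B.len (dOn B.len w) x)
      (fun t => g t * φ t), integral_leverArm_mul hL (hw.memLp.integrable (by norm_num)),
      ← hw.eq_prim hlen, ← hw.dOn_eq_prim hlen, ← integral_const_mul]
    congr 1; ext t; ring
  have hE : inner ℝ (beamOp hB z) χ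
      = ∫ p : ℝ × ℝ, (-(B.ρ p.1 * v p * w p.1 * deriv φ p.2) + B.μ p.1 * v p * w p.1 * φ p.2
        + (B.r p.1 * du p + B.κ p.1 * dv p) * dOn B.len (dOn B.len w) p.1 * φ p.2) ∂B.lebΩ := by
    rw [beamOp_apply, inner_add_left, inner_massOp, inner_timeInt, inner_add_left, dampOp, stiffOp,
      add_apply, inner_add_left, inner_massOp, inner_mulOp, inner_mulOp,
      inner_mulOp, inner_mulOp, lebΩ_eq, ← integral_add, ← integral_add, ← integral_add]
    · refine integral_congr_ae ?_
      filter_upwards [hv, hdv, hdu, hPχ, hψe, hPψ] with p h1 h2 h3 h4 h5 h6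
      rw [h1, h2, h3, h4, h5, h6]; ring
    · exact integrable_mulOp_mul hB.ρ_mem _ _
    · exact ((integrable_mulOp_mul hB.μ_mem _ _).add (integrable_mulOp_mul hB.κ_mem _ _)).add
        (integrable_mulOp_mul hB.r_mem _ _)
    · exact (integrable_mulOp_mul hB.μ_mem _ _).add (integrable_mulOp_mul hB.κ_mem _ _)
    · exact integrable_mulOp_mul hB.r_mem _ _
    · exact integrable_mulOp_mul hB.μ_mem _ _
    · exact integrable_mulOp_mul hB.κ_mem _ _
  rw [inner_sub_left, sub_eq_zero, hE, hF]

end TestFunctions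

/-- Products of second derivatives of elements of `V` and derivatives of test functions are
total in `L²`. -/
theorem eq_zero_of_inner_testFn (hL : 0 < B.len) {Y : Lp ℝ 2 (rect B.len B.T)}
    (h : ∀ (w : ℝ → ℝ) (hw : MemV B.len w) (φ : ℝ → ℝ) (hφ : ContDiff ℝ ∞ φ), φ B.T = 0 →
      inner ℝ Y (B.testFn hw hφ) = 0) : Y = 0 := by
  refine Lp.ext (Filter.EventuallyEq.trans ?_ (Lp.coeFn_zero ℝ 2 _).symm)
  refine eq_zero_of_integral_tensor (Lp.memLp Y) fun z hz η hη => ?_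
  have hw : MemV B.len (prim (prim z)) := memV_of_eq_prim_prim hL hz fun _ _ => rfl
  have hwz := dOn_dOn_of_eq_prim_prim hL (hz.integrable (by norm_num)) (fun x _ => rfl)
    (f := prim (prim z))
  have hη' : ContDiff ℝ ∞ fun t => -η t := hη.neg
  have hd : ∀ t, HasDerivAt (fun t => ∫ s in B.T..t, -η s) (-η t) t := fun t =>
    intervalIntegral.integral_hasDerivAt_right (hη'.continuous.intervalIntegrable _ _)
      (hη'.continuous.stronglyMeasurableAtFilter _ _) hη'.continuous.continuousAt
  have hde : deriv (fun t => ∫ s in B.T..t, -η s) = fun t => -η t := funext fun t => (hd t).deriv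
  have hφ : ContDiff ℝ ∞ fun t => ∫ s in B.T..t, -η s := by
    rw [contDiff_infty_iff_deriv]
    exact ⟨fun t => (hd t).differentiableAt, by rw [hde]; exact hη'⟩
  have := h _ hw _ hφ (by simp)
  rw [← this, inner_l2]
  refine integral_congr_ae ?_
  filter_upwards [coeFn_testFn hw hφ, Measure.quasiMeasurePreserving_fst.ae hwz] with p h1 h2
  rw [h1, h2, hde, neg_neg]

end Beam

theorem integral_mul_sq_le {Ω : Type*} [MeasurableSpace Ω] {μ : Measure Ω} {f g : Ω → ℝ}
    (hf : MemLp f 2 μ) (hg : MemLp g 2 μ) :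
    (∫ x, f x * g x ∂μ) ^ 2 ≤ (∫ x, f x ^ 2 ∂μ) * ∫ x, g x ^ 2 ∂μ := by
  have e : ∀ {u v : Ω → ℝ} (hu : MemLp u 2 μ) (hv : MemLp v 2 μ),
      inner ℝ (hu.toLp u) (hv.toLp v) = ∫ x, u x * v x ∂μ := fun hu hv => by
    rw [inner_l2]
    refine integral_congr_ae ?_
    filter_upwards [hu.coeFn_toLp, hv.coeFn_toLp] with x h1 h2
    rw [h1, h2]
  have h := real_inner_mul_inner_self_le (hf.toLp f) (hg.toLp g)
  rw [e, e, e] at h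
  simpa only [sq] using h

theorem eLpNorm_le_of_integral_sq_le {Ω : Type*} [MeasurableSpace Ω] {μ : Measure Ω} {f g : Ω → ℝ}
    (hf : MemLp f 2 μ) (hg : MemLp g 2 μ) {C : ℝ} (hC : 0 ≤ C)
    (h : ∫ x, f x ^ 2 ∂μ ≤ C ^ 2 * ∫ x, g x ^ 2 ∂μ) :
    eLpNorm f 2 μ ≤ ENNReal.ofReal C * eLpNorm g 2 μ := by
  have e : ∀ {u : Ω → ℝ} (hu : MemLp u 2 μ), ‖hu.toLp u‖ ^ 2 = ∫ x, u x ^ 2 ∂μ := fun hu => by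
    rw [← real_inner_self_eq_norm_sq, inner_l2]
    refine integral_congr_ae ?_
    filter_upwards [hu.coeFn_toLp] with x h1
    rw [h1, sq]
  rw [← e hf, ← e hg, ← mul_pow] at h
  have h' := le_of_sq_le_sq h (by positivity)
  rw [Lp.norm_toLp, Lp.norm_toLp] at h'
  rw [← ENNReal.ofReal_toReal hf.2.ne, ← ENNReal.ofReal_toReal hg.2.ne, ← ENNReal.ofReal_mul hC]
  exact ENNReal.ofReal_le_ofReal h'

section Fubini

variable {L T : ℝ}

theorem prim_integral_comm {f : ℝ × ℝ → ℝ} (hf : Integrable f (rect L T)) {t : ℝ}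
    (ht : t ∈ Icc 0 T) :
    prim (fun s => ∫ x, f (x, s) ∂(leb L)) t = ∫ x, prim (fun s => f (x, s)) t ∂(leb L) := by
  simp only [← integral_volterra ht, ← integral_const_mul]
  refine (integral_integral_swap (f := fun x s => UnitKernel.volterra.toFun t s * f (x, s)) ?_).symm
  exact hf.bdd_mul (c := 1) ((UnitKernel.volterra.meas.comp
    (by fun_prop : Measurable fun p : ℝ × ℝ => (t, p.2))).aestronglyMeasurable)
    (Filter.Eventually.of_forall fun _ => UnitKernel.volterra.bound _ _)

theorem integrable_prim_fst_at {f : ℝ × ℝ → ℝ} (hf : Integrable f (rect L T)) {x : ℝ}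
    (hx : x ∈ Icc 0 L) : Integrable (fun t => prim (fun y => f (y, t)) x) (leb T) := by
  simp only [← integral_volterra hx]
  have : Integrable (fun p : ℝ × ℝ => UnitKernel.volterra.toFun x p.1 * f p) (rect L T) :=
    hf.bdd_mul (c := 1) ((UnitKernel.volterra.meas.comp
      (by fun_prop : Measurable fun p : ℝ × ℝ => (x, p.1))).aestronglyMeasurable)
      (Filter.Eventually.of_forall fun _ => UnitKernel.volterra.bound _ _)
  exact this.integral_prod_right

theorem integrable_prim_prim_at {f : ℝ × ℝ → ℝ} (hf : MemLp f 2 (rect L T)) {x : ℝ}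
    (hx : x ∈ Icc 0 L) : Integrable (fun t => prim (prim fun y => f (y, t)) x) (leb T) :=
  integrable_prim_fst_at (f := fun p => prim (fun y => f (y, p.2)) p.1)
    ((memLp_prim_fst hf).integrable (by norm_num)) hx

theorem eqOn_Icc_of_ae_leb (hT : 0 < T) {f g : ℝ → ℝ} (hf : ContinuousOn f (Icc 0 T))
    (hg : ContinuousOn g (Icc 0 T)) (h : f =ᵐ[leb T] g) : EqOn f g (Icc 0 T) := by
  refine Measure.eqOn_Icc_of_ae_eq volume hT.ne ?_ hf hg
  rwa [← restrict_Ioo_eq_restrict_Icc]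

end Fubini

/-- Gronwall's inequality in integral form, with the conclusion on the integral. -/
theorem integral_le_of_le_add_prim {T C : ℝ} (hT : 0 ≤ T) (hC : 0 ≤ C) {y : ℝ → ℝ}
    (hy : Integrable y (leb T)) (h : ∀ᵐ s ∂(leb T), y s ≤ C + prim y s) :
    ∫ s, y s ∂(leb T) ≤ C * Real.exp T := by
  have hTm : T ∈ Icc 0 T := ⟨hT, le_rfl⟩
  have hcexp : Continuous fun s : ℝ => -Real.exp (-s) := by fun_prop
  have hg : Integrable (fun s => -Real.exp (-s)) (leb T) :=
    (memLp_of_continuous hcexp).integrable (by norm_num)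
  have hpg : ∀ s, prim (fun s => -Real.exp (-s)) s = Real.exp (-s) - 1 := fun s => by
    have : ∀ x ∈ uIcc 0 s, HasDerivAt (fun s : ℝ => Real.exp (-s)) (-Real.exp (-x)) x := fun x _ => by
      simpa using (hasDerivAt_neg x).exp
    rw [prim, intervalIntegral.integral_eq_sub_of_hasDerivAt this (hcexp.intervalIntegrable _ _)]
    simp
  have h1 := integral_mul_prim hy hg hTm
  have hyi := (integrable_leb_iff hT y).1 hy
  have hYe : Integrable (fun s => prim y s * Real.exp (-s)) (leb T) := by
    rw [integrable_leb_iff hT]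
    refine ContinuousOn.intervalIntegrable ?_
    rw [uIcc_of_le hT]
    exact (continuousOn_prim hy).mul (by fun_prop)
  have hye : Integrable (fun s => y s * Real.exp (-s)) (leb T) := by
    rw [integrable_leb_iff hT]
    exact hyi.mul_continuousOn (by fun_prop)
  have hE : Integrable (fun s => Real.exp (-s)) (leb T) := by simpa using hg.neg
  have h2 : ∫ s, (y s * Real.exp (-s) - prim y s * Real.exp (-s)) ∂(leb T)
      = Real.exp (-T) * ∫ s, y s ∂(leb T) := by
    have h3 : prim y T = ∫ s, y s ∂(leb T) := (integral_leb hT y).symm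
    have h4 : ∫ s in (0 : ℝ)..T, (y s * prim (fun s => -Real.exp (-s)) s + prim y s * -Real.exp (-s))
        = ∫ s, (y s * Real.exp (-s) - prim y s * Real.exp (-s)) - y s ∂(leb T) := by
      rw [integral_leb hT]
      congr 1; ext s; rw [hpg]; ring
    have h5 : Integrable (fun s => y s * Real.exp (-s) - prim y s * Real.exp (-s)) (leb T) :=
      hye.sub hYe
    rw [h4, integral_sub h5 hy, hpg, h3] at h1
    linarith
  have h5 : ∫ s, (y s * Real.exp (-s) - prim y s * Real.exp (-s)) ∂(leb T)
      ≤ ∫ s, C * Real.exp (-s) ∂(leb T) := by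
    refine integral_mono_ae (hye.sub hYe) (hE.const_mul C) ?_
    filter_upwards [h] with s hs
    have := mul_le_mul_of_nonneg_right hs (Real.exp_pos (-s)).le
    linarith
  have h6 : ∫ s, Real.exp (-s) ∂(leb T) ≤ 1 := by
    have := hpg T
    rw [prim, ← integral_leb hT, integral_neg] at this
    linarith [Real.exp_pos (-T)]
  rw [h2, integral_const_mul] at h5
  have h7 : Real.exp (-T) * ∫ s, y s ∂(leb T) ≤ C := h5.trans (by nlinarith)
  calc ∫ s, y s ∂(leb T) = Real.exp T * (Real.exp (-T) * ∫ s, y s ∂(leb T)) := by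
        rw [← mul_assoc, ← Real.exp_add]; simp
    _ ≤ Real.exp T * C := by gcongr
    _ = _ := mul_comm _ _

namespace Beam

variable {B : Beam}

theorem exists_isWeakSolution (hB : B.BasicConditions) {g : ℝ → ℝ} (hg : MemLp g 2 (leb B.T)) :
    ∃ u, B.IsWeakSolution g u := by
  obtain ⟨z, hz⟩ := exists_beamOp_eq hB (B.force g hg)
  have hzm := Lp.memLp z
  have hT := hB.T_pos.le
  have hL := hB.len_pos
  let v : ℝ → ℝ → ℝ := fun x t => prim (prim fun y => z (y, t)) x
  have hu : ∀ x ∈ Icc 0 B.len, ∀ t ∈ Icc 0 B.T,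
      prim (v x) t = prim (prim fun y => prim (fun s => z (y, s)) t) x :=
    fun x hx t ht => prim_prim_prim_comm hzm hx ht
  have hU : ∀ᵐ t ∂(leb B.T), ∀ x ∈ Icc 0 B.len,
      prim (v x) t = prim (prim fun y => prim (fun s => z (y, s)) t) x :=
    (ae_leb_mem B.T).mono fun t ht x hx => hu x hx t (Ioo_subset_Icc_self ht)
  have hV : ∀ᵐ t ∂(leb B.T), ∀ x ∈ Icc 0 B.len, v x t = prim (prim fun y => z (y, t)) x :=
    Filter.Eventually.of_forall fun t x _ => rfl
  refine ⟨fun x t => prim (v x) t, memL2V_of_eq_prim_prim hL (memLp_prim_snd hzm) hU,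
    fun x _ => by simp [prim], v, memL2V_of_eq_prim_prim hL hzm hV, fun x hx => ⟨?_, ?_⟩, ?_⟩
  · exact (integrable_leb_iff hT _).1 (integrable_prim_prim_at hzm hx)
  · intro t _
    simp [prim]
  · intro w hw φ hφ hφT
    refine (weak_form_iff hB hw hφ hg hφT (z := z) (v := fun p => v p.1 p.2)
      (dv := fun p => B.dxx v p.1 p.2) (du := fun p => B.dxx (fun x t => prim (v x) t) p.1 p.2)
      (coeFn_spaceInt z).symm (ae_dOn_dOn_eq hL hzm hV) ?_).2 ?_
    · exact (ae_dOn_dOn_eq hL (memLp_prim_snd hzm) hU).trans (coeFn_timeInt z).symm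
    · rw [hz, sub_self, inner_zero_left]

/-- A weak solution is the double primitive in space of the time integral of an `L²` solution of
the operator equation. -/
theorem IsWeakSolution.exists_beamOp_eq (hB : B.BasicConditions) {g : ℝ → ℝ}
    (hg : MemLp g 2 (leb B.T)) {u : ℝ → ℝ → ℝ} (hu : B.IsWeakSolution g u) :
    ∃ z, beamOp hB z = timeInt B.len B.T (B.force g hg) ∧ ∀ x ∈ Icc 0 B.len, ∀ t ∈ Icc 0 B.T,
      u x t = prim (fun s => prim (prim fun y => z (y, s)) x) t := by
  obtain ⟨-, hu0, v, hv, huv, hweak⟩ := hu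
  have hL := hB.len_pos
  have hdv := hv.memLp_dxx
  rw [lebΩ_eq] at hdv
  set z := hdv.toLp _ with hz
  have hzm := Lp.memLp z
  have hze : z =ᵐ[rect B.len B.T] fun p => B.dxx v p.1 p.2 := hdv.coeFn_toLp
  have hV : ∀ᵐ t ∂(leb B.T), ∀ x ∈ Icc 0 B.len, v x t = prim (prim fun y => z (y, t)) x := by
    filter_upwards [hv.mem_V, ae_ae_snd hze] with t h1 h2 x hx
    rw [h1.eq_prim hx]
    refine prim_congr_ae ?_ hx
    filter_upwards [ae_leb_mem B.len] with y hy
    exact prim_congr_ae (Filter.EventuallyEq.symm h2) (Ioo_subset_Icc_self hy)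
  have hU : ∀ x ∈ Icc 0 B.len, ∀ t ∈ Icc 0 B.T,
      u x t = prim (fun s => prim (prim fun y => z (y, s)) x) t := by
    intro x hx t ht
    rw [(huv x hx).2 t ht, hu0 x hx, zero_add]
    exact prim_congr_ae (hV.mono fun t ht => ht x hx) ht
  refine ⟨z, sub_eq_zero.1 (eq_zero_of_inner_testFn hL fun w hw φ hφ hφT => ?_), hU⟩
  refine (weak_form_iff hB hw hφ hg hφT (v := fun p => v p.1 p.2)
    (dv := fun p => B.dxx v p.1 p.2) (du := fun p => B.dxx u p.1 p.2) ?_ hze.symm ?_).1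
    (hweak w hw φ hφ hφT)
  · filter_upwards [coeFn_spaceInt z, Measure.quasiMeasurePreserving_snd.ae hV,
      ae_rect_mem B.len B.T] with p h1 h2 h3
    rw [h1]
    exact h2 _ (Ioo_subset_Icc_self h3.1)
  · refine (ae_dOn_dOn_eq hL (memLp_prim_snd hzm) ?_).trans (coeFn_timeInt z).symm
    filter_upwards [ae_leb_mem B.T] with t ht x hx
    rw [hU x hx t (Ioo_subset_Icc_self ht)]
    exact prim_prim_prim_comm hzm hx (Ioo_subset_Icc_self ht)

theorem IsWeakSolution.unique (hB : B.BasicConditions) {g : ℝ → ℝ}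
    (hg : MemLp g 2 (leb B.T)) {u u' : ℝ → ℝ → ℝ} (hu : B.IsWeakSolution g u)
    (hu' : B.IsWeakSolution g u') : ∀ x ∈ Icc 0 B.len, ∀ t ∈ Icc 0 B.T, u' x t = u x t := by
  obtain ⟨z, hz, hzu⟩ := hu.exists_beamOp_eq hB hg
  obtain ⟨z', hz', hzu'⟩ := hu'.exists_beamOp_eq hB hg
  have h0 := timeInt_eq_zero_of_beamOp hB (z := z' - z) (by rw [map_sub, hz, hz', sub_self])
  rw [map_sub, sub_eq_zero] at h0
  have he : (fun p : ℝ × ℝ => prim (fun s => z' (p.1, s)) p.2) =ᵐ[rect B.len B.T]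
      fun p => prim (fun s => z (p.1, s)) p.2 :=
    (coeFn_timeInt z').symm.trans (h0 ▸ coeFn_timeInt z)
  intro x hx
  have hc : ∀ y : Lp ℝ 2 (rect B.len B.T),
      ContinuousOn (fun t => prim (fun s => prim (prim fun ξ => y (ξ, s)) x) t) (Icc 0 B.T) :=
    fun y => continuousOn_prim (integrable_prim_prim_at (Lp.memLp y) hx)
  have h1 := eqOn_Icc_of_ae_leb hB.T_pos (hc z') (hc z) (by
    filter_upwards [ae_ae_snd he, ae_leb_mem B.T] with t h1 h2
    have ht := Ioo_subset_Icc_self h2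
    rw [prim_prim_prim_comm (Lp.memLp z') hx ht, prim_prim_prim_comm (Lp.memLp z) hx ht]
    refine prim_congr_ae ?_ hx
    filter_upwards [ae_leb_mem B.len] with y hy
    exact prim_congr_ae h1 (Ioo_subset_Icc_self hy))
  intro t ht
  rw [hzu x hx t ht, hzu' x hx t ht]
  exact h1 ht

end Beam

theorem prim_mono_ae {T t : ℝ} {f g : ℝ → ℝ} (hf : Integrable f (leb T)) (hg : Integrable g (leb T))
    (h : ∀ᵐ s ∂(leb T), f s ≤ g s) (ht : t ∈ Icc 0 T) : prim f t ≤ prim g t := by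
  rw [← integral_volterra ht, ← integral_volterra ht]
  refine integral_mono_ae (UnitKernel.volterra.integrable_kernel_mul t hf)
    (UnitKernel.volterra.integrable_kernel_mul t hg) ?_
  filter_upwards [h] with s hs
  have : 0 ≤ UnitKernel.volterra.toFun t s := by
    simp only [UnitKernel.volterra]; split_ifs <;> norm_num
  exact mul_le_mul_of_nonneg_left hs this

theorem integral_sub_add_sq {L : ℝ} (hL : 0 ≤ L) (c : ℝ) :
    ∫ x, ((L - x) + c) ^ 2 ∂(leb L) = ((L + c) ^ 3 - c ^ 3) / 3 := by
  have h := intervalIntegral.integral_comp_sub_left (a := 0) (b := L) (fun x : ℝ => x ^ 2) (L + c)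
  rw [integral_leb hL]
  calc ∫ x in (0 : ℝ)..L, ((L - x) + c) ^ 2 = ∫ x in (0 : ℝ)..L, (L + c - x) ^ 2 := by
        congr 1; ext x; ring
    _ = _ := by rw [h, integral_pow]; norm_num

theorem prim_sq_le {T t : ℝ} {k : ℝ → ℝ} (hk : MemLp k 2 (leb T)) (ht : t ∈ Icc 0 T) :
    prim k t ^ 2 ≤ T * ∫ s, k s ^ 2 ∂(leb T) := by
  have hT : 0 ≤ T := ht.1.trans ht.2
  have hv : MemLp (UnitKernel.volterra.toFun t) 2 (leb T) :=
    MemLp.of_bound (UnitKernel.volterra.meas.comp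
      (by fun_prop : Measurable fun s : ℝ => (t, s))).aestronglyMeasurable 1
      (Filter.Eventually.of_forall fun _ => UnitKernel.volterra.bound _ _)
  have h := integral_mul_sq_le hv hk
  rw [integral_volterra ht] at h
  refine h.trans (mul_le_mul_of_nonneg_right ?_ (integral_nonneg fun _ => sq_nonneg _))
  calc ∫ s, UnitKernel.volterra.toFun t s ^ 2 ∂(leb T) ≤ ∫ _, 1 ∂(leb T) := by
        refine integral_mono hv.integrable_sq (integrable_const _) fun s => ?_
        simp only [UnitKernel.volterra]; split_ifs <;> norm_num
    _ = T := by rw [integral_leb hT]; simp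

theorem inner_mulOp_timeInt_cutoff {L T : ℝ} {m : ℝ → ℝ} (hm : MemLp m ∞ (leb L)) {s : ℝ}
    (hs : s ∈ Icc 0 T) (f : Lp ℝ 2 (rect L T)) :
    inner ℝ (mulOp _ (memLp_top_fst hm) (timeInt L T f)) (cutoff L T s f)
      = ∫ x, m x * (prim (fun t => f (x, t)) s ^ 2 / 2) ∂(leb L) := by
  rw [← inner_mulOp_cutoff_timeInt hm hs, inner_cutoff hs, inner_cutoff hs]
  refine integral_congr_ae ?_
  filter_upwards [Measure.ae_ae_of_ae_prod (coeFn_mulOp _ (memLp_top_fst (T := T) hm) f),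
    Measure.ae_ae_of_ae_prod (coeFn_mulOp _ (memLp_top_fst (T := T) hm) (timeInt L T f))]
    with x h2 h3
  refine prim_congr_ae ?_ hs
  filter_upwards [h2, h3] with t h2 h3
  rw [h2, h3]; ring

namespace Beam

variable {B : Beam}

/-- The energy inequality for a solution that is one order smoother in time. -/
theorem inner_stiffOp_cutoff_le (hB : B.BasicConditions) {z F : Lp ℝ 2 (rect B.len B.T)}
    (hz : beamOp hB z = F) {s : ℝ} (hs : s ∈ Icc 0 B.T) :
    inner ℝ (stiffOp hB (timeInt B.len B.T (timeInt B.len B.T z)))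
        (cutoff B.len B.T s (timeInt B.len B.T z))
      ≤ inner ℝ F (cutoff B.len B.T s (timeInt B.len B.T z)) := by
  rw [← hz, beamOp_apply, map_add, timeInt_dampOp, timeInt_stiffOp]
  set a := timeInt B.len B.T z with ha
  rw [inner_add_left, inner_add_left, dampOp, add_apply, inner_add_left,
    inner_massOp, inner_massOp, spaceInt_cutoff]
  have h1 := inner_mulOp_cutoff_timeInt_nonneg hB.ρ_mem hB.ρ_nonneg hs (spaceInt B.len B.T z)
  rw [← spaceInt_timeInt, ← ha] at h1
  have h2 := inner_mulOp_cutoff_nonneg hB.μ_mem hB.μ_nonneg s (spaceInt B.len B.T a)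
  have h3 := inner_mulOp_cutoff_nonneg hB.κ_mem hB.κ_nonneg s a
  linarith

theorem coeFn_timeInt_force {k : ℝ → ℝ} (hk : MemLp k 2 (leb B.T)) :
    timeInt B.len B.T (B.force k hk) =ᵐ[rect B.len B.T] fun p => B.leverArm p.1 * prim k p.2 := by
  filter_upwards [coeFn_timeInt (B.force k hk), ae_rect_mem B.len B.T,
    Measure.quasiMeasurePreserving_fst.ae (Measure.ae_ae_of_ae_prod (coeFn_force hk))] with p h1 h2 h3
  rw [h1, prim_congr_ae h3 (Ioo_subset_Icc_self h2.2)]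
  exact intervalIntegral.integral_const_mul _ _

theorem integral_leverArm_sq_le (hL : 0 < B.len) :
    ∫ x, B.leverArm x ^ 2 ∂(leb B.len) ≤ (1 + B.CθSq) * (B.len + B.len ^ 3 / 3) := by
  have h := integral_sub_add_sq hL.le B.momentFactor
  have hc : B.CθSq = B.momentFactor ^ 2 := rfl
  rw [hc]
  calc ∫ x, B.leverArm x ^ 2 ∂(leb B.len)
      = ((B.len + B.momentFactor) ^ 3 - B.momentFactor ^ 3) / 3 := h
    _ ≤ _ := by
      nlinarith [mul_nonneg hL.le (sq_nonneg (B.momentFactor * B.len / 2 - 1)),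
        mul_nonneg hL.le (sq_nonneg (B.momentFactor * B.len))]

/-- Work of the boundary forces up to the time `s`. -/
theorem inner_timeInt_force_cutoff {k : ℝ → ℝ} (hk : MemLp k 2 (leb B.T))
    (a : Lp ℝ 2 (rect B.len B.T)) {s : ℝ} (hs : s ∈ Icc 0 B.T) :
    inner ℝ (timeInt B.len B.T (B.force k hk)) (cutoff B.len B.T s a)
      = prim (fun t => (∫ x, B.leverArm x * a (x, t) ∂(leb B.len)) * prim k t) s := by
  rw [inner_cutoff hs]
  have hi : Integrable (fun p : ℝ × ℝ => B.leverArm p.1 * prim k p.2 * a p) (rect B.len B.T) := by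
    refine ((Lp.memLp (timeInt B.len B.T (B.force k hk))).integrable_mul (Lp.memLp a)).congr ?_
    filter_upwards [coeFn_timeInt_force hk] with p hp
    rw [Pi.mul_apply, hp]
  have h2 := prim_integral_comm hi hs
  calc ∫ x, prim (fun t => timeInt B.len B.T (B.force k hk) (x, t) * a (x, t)) s ∂(leb B.len)
      = ∫ x, prim (fun t => B.leverArm x * prim k t * a (x, t)) s ∂(leb B.len) := by
        refine integral_congr_ae ?_
        filter_upwards [Measure.ae_ae_of_ae_prod (coeFn_timeInt_force hk)] with x hx
        refine prim_congr_ae ?_ hs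
        filter_upwards [hx] with t ht
        rw [ht]
    _ = _ := by
        rw [← h2]
        congr 1; ext t
        rw [← integral_mul_const]
        congr 1; ext x; ring

/-- The energy estimate, in terms of the bending `b = u_xx`. -/
theorem integral_sq_timeInt_le (hB : B.BasicConditions) {k : ℝ → ℝ} (hk : MemLp k 2 (leb B.T))
    {z : Lp ℝ 2 (rect B.len B.T)} (hz : beamOp hB z = timeInt B.len B.T (B.force k hk)) :
    ∫ t, ∫ x, (timeInt B.len B.T (timeInt B.len B.T z) (x, t)) ^ 2 ∂(leb B.len) ∂(leb B.T)
      ≤ B.C1 ^ 2 * ∫ t, k t ^ 2 ∂(leb B.T) := by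
  have hL := hB.len_pos
  have hT := hB.T_pos
  have hr := hB.r₀_pos
  set a := timeInt B.len B.T z with ha
  set b := timeInt B.len B.T a with hb
  set N := ∫ t, k t ^ 2 ∂(leb B.T) with hN
  have hN0 : 0 ≤ N := integral_nonneg fun _ => sq_nonneg _
  set K := (1 + B.CθSq) * (B.len + B.len ^ 3 / 3) with hK
  have hθ : 0 ≤ B.CθSq := sq_nonneg _
  have hK0 : 0 < K := by positivity
  let y : ℝ → ℝ := fun t => ∫ x, b (x, t) ^ 2 ∂(leb B.len)
  have hy0 : ∀ t, 0 ≤ y t := fun t => integral_nonneg fun _ => sq_nonneg _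
  have hyi : Integrable y (leb B.T) := (Lp.memLp b).integrable_sq.integral_prod_right
  let p : ℝ → ℝ := fun t => ∫ x, B.leverArm x * a (x, t) ∂(leb B.len)
  have hpi' : Integrable (fun q : ℝ × ℝ => B.leverArm q.1 * a q) (rect B.len B.T) :=
    ((memLp_of_continuous (T := B.len) B.continuous_leverArm).comp_fst _).integrable_mul (Lp.memLp a)
  have hpi : Integrable p (leb B.T) := hpi'.integral_prod_right
  have hki := hk.integrable (q := 2) (by norm_num)
  have hbs : ∀ᵐ t ∂(leb B.T), (fun x => b (x, t)) =ᵐ[leb B.len] fun x => prim (fun s => a (x, s)) t :=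
    ae_ae_snd (coeFn_timeInt a)
  have hq : ∀ᵐ t ∂(leb B.T), prim p t ^ 2 ≤ K * y t := by
    filter_upwards [hbs, ae_leb_mem B.T, ae_slice_snd_integrable (Lp.memLp b)] with t h1 h2 h3
    have h4 : prim p t = ∫ x, B.leverArm x * b (x, t) ∂(leb B.len) := by
      rw [prim_integral_comm hpi' (Ioo_subset_Icc_self h2)]
      refine integral_congr_ae ?_
      filter_upwards [h1] with x hx
      rw [hx]
      exact intervalIntegral.integral_const_mul _ _
    rw [h4]
    refine (integral_mul_sq_le (memLp_of_continuous B.continuous_leverArm) h3.1).trans ?_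
    exact mul_le_mul_of_nonneg_right (integral_leverArm_sq_le hL) (hy0 t)
  have hkq : Integrable (fun s => k s * prim p s) (leb B.T) := integrable_mul_prim hki hpi
  have hbd : Integrable (fun s => B.r₀ / 4 * y s + K / B.r₀ * k s ^ 2) (leb B.T) :=
    (hyi.const_mul _).add (hk.integrable_sq.const_mul _)
  have young : ∀ u w Y : ℝ, w ^ 2 ≤ K * Y → -(u * w) ≤ B.r₀ / 4 * Y + K / B.r₀ * u ^ 2 := by
    intro u w Y hw
    have h1 : 0 ≤ B.r₀ / (4 * K) * (w + 2 * K / B.r₀ * u) ^ 2 := by positivity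
    have h2 : B.r₀ / (4 * K) * (w + 2 * K / B.r₀ * u) ^ 2
        = B.r₀ / (4 * K) * w ^ 2 + u * w + K / B.r₀ * u ^ 2 := by
      field_simp; ring
    have h3 : B.r₀ / (4 * K) * w ^ 2 ≤ B.r₀ / (4 * K) * (K * Y) := by gcongr
    have h4 : B.r₀ / (4 * K) * (K * Y) = B.r₀ / 4 * Y := by field_simp
    linarith
  have hmain : ∀ᵐ s ∂(leb B.T), y s ≤ 4 * K * (1 + B.T) * N / B.r₀ ^ 2 + prim y s := by
    filter_upwards [hbs, ae_leb_mem B.T, ae_slice_snd_integrable (Lp.memLp b), hq] with s h1 h2 h3 h4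
    have hs := Ioo_subset_Icc_self h2
    have e1 := inner_stiffOp_cutoff_le hB hz hs
    rw [inner_timeInt_force_cutoff hk _ hs, stiffOp, inner_mulOp_timeInt_cutoff hB.r_mem hs] at e1
    have e2 : B.r₀ / 2 * y s ≤ ∫ x, B.r x * (prim (fun t => a (x, t)) s ^ 2 / 2) ∂(leb B.len) := by
      rw [← integral_const_mul]
      have hrb : Integrable (fun x => B.r x * (prim (fun t => a (x, t)) s ^ 2 / 2)) (leb B.len) := by
        have h5 : MemLp (fun x => B.r x * b (x, s)) 2 (leb B.len) := h3.1.mul' (p := ∞) hB.r_mem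
        refine ((h5.integrable_mul h3.1).div_const 2).congr ?_
        filter_upwards [h1] with x hx
        rw [← hx, Pi.mul_apply]; ring
      refine integral_mono_ae (h3.1.integrable_sq.const_mul _) hrb ?_
      filter_upwards [h1, hB.r_bounds] with x hx hrx
      rw [← hx]
      have := mul_le_mul_of_nonneg_right hrx.1 (sq_nonneg (b (x, s)))
      linarith
    have e3 : prim (fun t => p t * prim k t) s = prim p s * prim k s - prim (fun t => k t * prim p t) s := by
      rw [← integral_mul_prim hpi hki hs]
      have i1 := intervalIntegrable_of_leb (integrable_mul_prim hpi hki) ⟨le_rfl, hT.le⟩ hs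
      have i2 := intervalIntegrable_of_leb hkq ⟨le_rfl, hT.le⟩ hs
      rw [prim, prim, ← intervalIntegral.integral_sub (i1.add (by simpa only [mul_comm] using i2)) i2]
      congr 1; ext t; ring
    have e4 : -prim (fun t => k t * prim p t) s ≤ B.r₀ / 4 * prim y s + K / B.r₀ * N := by
      have e5 : prim (fun t => -(k t * prim p t)) s
          ≤ prim (fun t => B.r₀ / 4 * y t + K / B.r₀ * k t ^ 2) s := by
        refine prim_mono_ae hkq.neg hbd ?_ hs
        filter_upwards [hq] with t ht
        exact young _ _ _ ht
      have e6 : prim (fun t => B.r₀ / 4 * y t + K / B.r₀ * k t ^ 2) s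
          = B.r₀ / 4 * prim y s + K / B.r₀ * prim (fun t => k t ^ 2) s := by
        rw [prim, intervalIntegral.integral_add
          ((intervalIntegrable_of_leb hyi ⟨le_rfl, hT.le⟩ hs).const_mul _)
          ((intervalIntegrable_of_leb hk.integrable_sq ⟨le_rfl, hT.le⟩ hs).const_mul _),
          intervalIntegral.integral_const_mul, intervalIntegral.integral_const_mul]
        rfl
      have e7 : prim (fun t => k t ^ 2) s ≤ N := by
        rw [hN, integral_leb hT.le]
        exact intervalIntegral.integral_mono_interval le_rfl hs.1 hs.2
          (Filter.Eventually.of_forall fun _ => sq_nonneg _)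
          ((integrable_leb_iff hT.le _).1 hk.integrable_sq)
      have e8 : prim (fun t => -(k t * prim p t)) s = -prim (fun t => k t * prim p t) s :=
        intervalIntegral.integral_neg
      have e9 : K / B.r₀ * prim (fun t => k t ^ 2) s ≤ K / B.r₀ * N := by gcongr
      linarith
    have e10 : prim p s * prim k s ≤ B.r₀ / 4 * y s + K / B.r₀ * (B.T * N) := by
      have h5 := young (-prim k s) (prim p s) (y s) h4
      have h6 : K / B.r₀ * prim k s ^ 2 ≤ K / B.r₀ * (B.T * N) := by
        gcongr; exact prim_sq_le hk hs
      rw [neg_sq] at h5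
      linarith
    have e11 : B.r₀ / 4 * y s ≤ B.r₀ / 4 * (4 * K * (1 + B.T) * N / B.r₀ ^ 2 + prim y s) := by
      have h7 : B.r₀ / 4 * (4 * K * (1 + B.T) * N / B.r₀ ^ 2) = K / B.r₀ * (B.T * N) + K / B.r₀ * N := by
        field_simp; ring
      rw [mul_add, h7]
      have h8 : prim (fun t => (∫ x, B.leverArm x * a (x, t) ∂(leb B.len)) * prim k t) s
        = prim (fun t => p t * prim k t) s := rfl
      rw [h8, e3] at e1
      linarith
    exact le_of_mul_le_mul_left e11 (by positivity)
  have hC0 : 0 ≤ B.C0Sq := by unfold C0Sq; positivity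
  have hfin := integral_le_of_le_add_prim hT.le (by positivity) hyi hmain
  refine hfin.trans_eq ?_
  rw [C1, Real.sq_sqrt (by positivity), C0Sq, hK]
  field_simp

theorem integral_tip_sq_le (hB : B.BasicConditions) {k : ℝ → ℝ} (hk : MemLp k 2 (leb B.T))
    {z : Lp ℝ 2 (rect B.len B.T)}
    (hz : beamOp hB z = timeInt B.len B.T (timeInt B.len B.T (B.force k hk))) :
    ∫ t, prim (fun s => prim (prim fun y => z (y, s)) B.len) t ^ 2 ∂(leb B.T)
      ≤ B.L0 ^ 2 * ∫ t, k t ^ 2 ∂(leb B.T) := by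
  have hL := hB.len_pos
  obtain ⟨z', hz'⟩ := exists_beamOp_eq hB (B.force k hk)
  have h0 := timeInt_eq_zero_of_beamOp hB (z := z - timeInt B.len B.T z')
    (by rw [map_sub, hz, ← timeInt_beamOp, hz', sub_self])
  rw [map_sub, sub_eq_zero] at h0
  have hest := integral_sq_timeInt_le hB hk hz'
  rw [← h0] at hest
  set b := timeInt B.len B.T z with hb
  have hlen : B.len ∈ Icc 0 B.len := ⟨hL.le, le_rfl⟩
  have hpt : ∀ᵐ t ∂(leb B.T), prim (fun s => prim (prim fun y => z (y, s)) B.len) t ^ 2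
      ≤ B.len ^ 3 / 3 * ∫ x, b (x, t) ^ 2 ∂(leb B.len) := by
    filter_upwards [ae_ae_snd (coeFn_timeInt z), ae_leb_mem B.T,
      ae_slice_snd_integrable (Lp.memLp b)] with t h1 h2 h3
    have h4 : prim (fun s => prim (prim fun y => z (y, s)) B.len) t
        = ∫ x, (B.len - x) * b (x, t) ∂(leb B.len) := by
      rw [prim_prim_prim_comm (Lp.memLp z) hlen (Ioo_subset_Icc_self h2), integral_leb hL.le,
        ← prim_prim h3.2 hlen]
      refine prim_congr_ae ?_ hlen
      filter_upwards [ae_leb_mem B.len] with y hy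
      exact prim_congr_ae (Filter.EventuallyEq.symm h1) (Ioo_subset_Icc_self hy)
    rw [h4]
    refine (integral_mul_sq_le (memLp_of_continuous (by fun_prop)) h3.1).trans_eq ?_
    have := integral_sub_add_sq hL.le 0
    simp only [add_zero] at this
    rw [this]; ring
  have hyi : Integrable (fun t => ∫ x, b (x, t) ^ 2 ∂(leb B.len)) (leb B.T) :=
    (Lp.memLp b).integrable_sq.integral_prod_right
  calc ∫ t, prim (fun s => prim (prim fun y => z (y, s)) B.len) t ^ 2 ∂(leb B.T)
      ≤ ∫ t, B.len ^ 3 / 3 * ∫ x, b (x, t) ^ 2 ∂(leb B.len) ∂(leb B.T) :=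
        integral_mono_of_nonneg (Filter.Eventually.of_forall fun _ => sq_nonneg _)
          (hyi.const_mul _) hpt
    _ ≤ B.len ^ 3 / 3 * (B.C1 ^ 2 * ∫ t, k t ^ 2 ∂(leb B.T)) := by
        rw [integral_const_mul]; gcongr
    _ = _ := by
        rw [L0, mul_pow, Real.sq_sqrt (by positivity)]; ring

theorem L0_pos (hB : B.BasicConditions) : 0 < B.L0 := by
  have hL := hB.len_pos
  have hT := hB.T_pos
  have hr := hB.r₀_pos
  have hθ : 0 ≤ B.CθSq := sq_nonneg _
  have hC0 : 0 < B.C0Sq := by unfold C0Sq; positivity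
  unfold L0 C1
  positivity

theorem memLp_tip (hB : B.BasicConditions) (z : Lp ℝ 2 (rect B.len B.T)) :
    MemLp (fun t => prim (fun s => prim (prim fun y => z (y, s)) B.len) t) 2 (leb B.T) := by
  have hc := continuousOn_prim (integrable_prim_prim_at (Lp.memLp z)
    (⟨hB.len_pos.le, le_rfl⟩ : B.len ∈ Icc 0 B.len))
  obtain ⟨C, hC⟩ := isCompact_Icc.exists_bound_of_continuousOn hc
  exact MemLp.of_bound ((hc.mono Ioo_subset_Icc_self).aestronglyMeasurable measurableSet_Ioo) C
    ((ae_leb_mem B.T).mono fun t ht => hC t (Ioo_subset_Icc_self ht))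

theorem memLp_of_memH1 {T : ℝ} (hT : 0 ≤ T) {g : ℝ → ℝ} (hg : MemH1 T g) : MemLp g 2 (leb T) := by
  have hc : ContinuousOn g (Icc 0 T) := by simpa [uIcc_of_le hT] using hg.1.continuousOn
  obtain ⟨C, hC⟩ := isCompact_Icc.exists_bound_of_continuousOn hc
  exact MemLp.of_bound ((hc.mono Ioo_subset_Icc_self).aestronglyMeasurable measurableSet_Ioo) C
    ((ae_leb_mem T).mono fun t ht => hC t (Ioo_subset_Icc_self ht))

/-- The input-output map in terms of the solution of the operator equation. -/
theorem exists_neumannToDirichlet_eq (hB : B.BasicConditions) {g : ℝ → ℝ}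
    (hg : MemLp g 2 (leb B.T)) :
    ∃ z, beamOp hB z = timeInt B.len B.T (B.force g hg) ∧
      B.neumannToDirichlet g =ᵐ[leb B.T]
        fun t => prim (fun s => prim (prim fun y => z (y, s)) B.len) t := by
  have hex := exists_isWeakSolution hB hg
  obtain ⟨z, hz, hzu⟩ := hex.choose_spec.exists_beamOp_eq hB hg
  refine ⟨z, hz, ?_⟩
  filter_upwards [ae_leb_mem B.T] with t ht
  rw [neumannToDirichlet, dif_pos hex]
  exact hzu _ ⟨hB.len_pos.le, le_rfl⟩ t (Ioo_subset_Icc_self ht)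

theorem eLpNorm_neumannToDirichlet_sub_le (hB : B.BasicConditions) {g₁ g₂ : ℝ → ℝ}
    (h₁ : MemH1 B.T g₁) (h₂ : MemH1 B.T g₂) (h₁0 : g₁ 0 = 0) (h₂0 : g₂ 0 = 0) :
    eLpNorm (fun t => B.neumannToDirichlet g₁ t - B.neumannToDirichlet g₂ t) 2 (leb B.T) ≤
      ENNReal.ofReal B.L0 * eLpNorm (fun t => dOn B.T g₁ t - dOn B.T g₂ t) 2 (leb B.T) := by
  have hT := hB.T_pos.le
  have m₁ := memLp_of_memH1 hT h₁
  have m₂ := memLp_of_memH1 hT h₂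
  obtain ⟨z₁, hz₁, hΦ₁⟩ := exists_neumannToDirichlet_eq hB m₁
  obtain ⟨z₂, hz₂, hΦ₂⟩ := exists_neumannToDirichlet_eq hB m₂
  have hk : MemLp (fun t => dOn B.T g₁ t - dOn B.T g₂ t) 2 (leb B.T) := h₁.2.sub h₂.2
  have hlen : B.len ∈ Icc 0 B.len := ⟨hB.len_pos.le, le_rfl⟩
  have hF : timeInt B.len B.T (B.force _ hk) = B.force g₁ m₁ - B.force g₂ m₂ := by
    refine Lp.ext ((coeFn_timeInt_force hk).trans ?_)
    filter_upwards [Lp.coeFn_sub (B.force g₁ m₁) (B.force g₂ m₂), coeFn_force m₁, coeFn_force m₂,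
      ae_rect_mem B.len B.T] with p e1 e2 e3 hp
    have ht := Ioo_subset_Icc_self hp.2
    rw [e1, Pi.sub_apply, e2, e3, h₁.eq_prim ht, h₂.eq_prim ht, h₁0, h₂0]
    have : prim (fun t => dOn B.T g₁ t - dOn B.T g₂ t) p.2
        = prim (dOn B.T g₁) p.2 - prim (dOn B.T g₂) p.2 :=
      intervalIntegral.integral_sub
        (intervalIntegrable_of_leb (h₁.2.integrable (by norm_num)) ⟨le_rfl, hT⟩ ht)
        (intervalIntegrable_of_leb (h₂.2.integrable (by norm_num)) ⟨le_rfl, hT⟩ ht)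
    rw [this]; ring
  have hest := integral_tip_sq_le hB hk (z := z₁ - z₂)
    (by rw [hF, map_sub, map_sub, hz₁, hz₂])
  have hsub : (fun t => B.neumannToDirichlet g₁ t - B.neumannToDirichlet g₂ t) =ᵐ[leb B.T]
      fun t => prim (fun s => prim (prim fun y => (z₁ - z₂) (y, s)) B.len) t := by
    have hs : ∀ᵐ s ∂(leb B.T), prim (prim fun y => (z₁ - z₂) (y, s)) B.len
        = prim (prim fun y => z₁ (y, s)) B.len - prim (prim fun y => z₂ (y, s)) B.len := by
      filter_upwards [ae_ae_snd (Lp.coeFn_sub z₁ z₂), ae_slice_snd_integrable (Lp.memLp z₁),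
        ae_slice_snd_integrable (Lp.memLp z₂)] with s e1 i1 i2
      have e2 : ∀ x ∈ Icc 0 B.len, prim (fun y => (z₁ - z₂) (y, s)) x
          = prim (fun y => z₁ (y, s)) x - prim (fun y => z₂ (y, s)) x := fun x hx =>
        (prim_congr_ae e1 hx).trans (intervalIntegral.integral_sub
          (intervalIntegrable_of_leb i1.2 ⟨le_rfl, hlen.1⟩ hx)
          (intervalIntegrable_of_leb i2.2 ⟨le_rfl, hlen.1⟩ hx))
      have i3 : ∀ {f : ℝ → ℝ}, Integrable f (leb B.len) →
          IntervalIntegrable (prim f) volume 0 B.len := fun hf =>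
        (absolutelyContinuous_prim hlen.1 hf).continuousOn.intervalIntegrable
      have e3 : prim (prim fun y => (z₁ - z₂) (y, s)) B.len
          = prim (fun x => prim (fun y => z₁ (y, s)) x - prim (fun y => z₂ (y, s)) x) B.len :=
        prim_congr_ae ((ae_leb_mem B.len).mono fun x hx => e2 x (Ioo_subset_Icc_self hx)) hlen
      rw [e3]
      exact intervalIntegral.integral_sub (i3 i1.2) (i3 i2.2)
    filter_upwards [hΦ₁, hΦ₂, ae_leb_mem B.T] with t e1 e2 ht
    have ht' := Ioo_subset_Icc_self ht
    rw [e1, e2, prim_congr_ae hs ht']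
    exact (intervalIntegral.integral_sub
      (intervalIntegrable_of_leb (integrable_prim_prim_at (Lp.memLp z₁) hlen) ⟨le_rfl, hT⟩ ht')
      (intervalIntegrable_of_leb (integrable_prim_prim_at (Lp.memLp z₂) hlen) ⟨le_rfl, hT⟩ ht')).symm
  rw [eLpNorm_congr_ae hsub]
  exact eLpNorm_le_of_integral_sq_le (memLp_tip hB _) hk (L0_pos hB).le hest

end Beam

theorem lemma2 (B : Beam) (hB : B.BasicConditions) (Cg : ℝ) (hCg : 0 < Cg) :
    -- `Φ` is well defined on the admissible set, with values in `L²(0, T)`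
    (∀ g ∈ B.admissible Cg, ∃ u : ℝ → ℝ → ℝ, B.IsWeakSolution g u ∧
      (∀ u' : ℝ → ℝ → ℝ, B.IsWeakSolution g u' →
        ∀ x ∈ Icc 0 B.len, ∀ t ∈ Icc 0 B.T, u' x t = u x t)) ∧
    (∀ g ∈ B.admissible Cg, MemLp (B.neumannToDirichlet g) 2 (leb B.T)) ∧
    -- `Φ` is Lipschitz continuous with constant `L0`
    0 < B.L0 ∧
    ∀ g₁ ∈ B.admissible Cg, ∀ g₂ ∈ B.admissible Cg,
      eLpNorm (fun t => B.neumannToDirichlet g₁ t - B.neumannToDirichlet g₂ t) 2 (leb B.T) ≤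
        ENNReal.ofReal B.L0 *
          eLpNorm (fun t => dOn B.T g₁ t - dOn B.T g₂ t) 2 (leb B.T) := by
  have hT := hB.T_pos.le
  refine ⟨fun g hg => ?_, fun g hg => ?_, Beam.L0_pos hB, fun g₁ h₁ g₂ h₂ =>
    Beam.eLpNorm_neumannToDirichlet_sub_le hB h₁.1 h₂.1 h₁.2.1 h₂.2.1⟩
  · have hgm := Beam.memLp_of_memH1 hT hg.1
    obtain ⟨u, hu⟩ := Beam.exists_isWeakSolution hB hgm
    exact ⟨u, hu, fun u' hu' => hu.unique hB hgm hu'⟩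
  · obtain ⟨z, -, hz⟩ := Beam.exists_neumannToDirichlet_eq hB (Beam.memLp_of_memH1 hT hg.1)
    exact (memLp_congr_ae hz).2 (Beam.memLp_tip hB z)
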